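/- Let $B$ be a $C^*$-algebra and $E$ a Hilbert-$B$-module. An (unbounded, densely defined, $B$-linear) operator $A$ in $E$ is self-adjoint if $A=A^*$, where $A^*$ is the adjoint with respect to the $B$-valued inner product; a self-adjoint operator $A$ is regular if $A+z$ and $A-z$ have dense range for one (equivalently every) $z\in\mathbb{C}\setminus\mathbb{R}$. Products and sums of operators carry their natural domains: $\mathscr{D}(AC)=\{x\in\mathscr{D}(C) : Cx\in\mathscr{D}(A)\}$, $\mathscr{D}(A+C)=\mathscr{D}(A)\cap\mathscr{D}(C)$. For self-adjoint regular operators $S,T$ in $E$ put $$\mathscr{F}(S,T)=\{x\in\mathscr{D}(S)\cap\mathscr{D}(T) : Sx\in\mathscr{D}(T),\ Tx\in\mathscr{D}(S)\}.$$ The pair $(S,T)$ is called weakly anticommuting if (1) there are constants $C_0,C_1,C_2>0$ such that for all $x\in\mathscr{F}(S,T)$ $$\langle (ST+TS)x,(ST+TS)x\rangle\le C_0\langle x,x\rangle+C_1\langle Sx,Sx\rangle+C_2\langle Tx,Tx\rangle\quad\text{in } B;$$ (2) there are a core $\mathscr{E}\subset\mathscr{D}(T)$ for $T$ and $\lambda_0>0$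 such that $(S+\lambda)^{-1}(\mathscr{E})\subset\mathscr{F}(S,T)$ for all $\lambda\in i\mathbb{R}$ with $|\lambda|\ge\lambda_0$. **Theorem.** Let $(S,T)$ be a weakly anticommuting pair of self-adjoint regular operators in the Hilbert-$B$-module $E$. Then $S^2+T^2$ is self-adjoint and regular on $\mathscr{D}(S^2)\cap\mathscr{D}(T^2)$. Moreover, $$\mathscr{D}(S^2)\cap\mathscr{D}(T^2)=\mathscr{D}\big((S+T)^2\big)\subset\mathscr{F}(S,T).$$ -/

import Mathlib

namespace HilbertModule

/-- The product `A C` of two unbounded operators with its natural domain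
`{x ∈ D(C) | C x ∈ D(A)}`. -/
noncomputable def opMul {E : Type*} [AddCommGroup E] [Module ℂ E] (A C : E →ₗ.[ℂ] E) :
    E →ₗ.[ℂ] E :=
  A.comp (C.domRestrict ((A.domain.comap C.toFun).map C.domain.subtype)) (by
    rintro ⟨x, hx⟩
    obtain ⟨⟨y, hy, rfl⟩, hx2⟩ := Submodule.mem_inf.mp hx
    exact hy)

theorem mem_domain_opMul {E : Type*} [AddCommGroup E] [Module ℂ E] (A C : E →ₗ.[ℂ] E) (x : E) :
    x ∈ (opMul A C).domain ↔ ∃ hx : x ∈ C.domain, C ⟨x, hx⟩ ∈ A.domain := by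
  constructor
  · intro h
    obtain ⟨⟨y, hy, rfl⟩, hx2⟩ := Submodule.mem_inf.mp h
    exact ⟨y.2, hy⟩
  · rintro ⟨hx, h⟩
    exact Submodule.mem_inf.mpr ⟨⟨⟨x, hx⟩, h, rfl⟩, hx⟩

theorem opMul_apply {E : Type*} [AddCommGroup E] [Module ℂ E] (A C : E →ₗ.[ℂ] E) (x : E)
    (h : x ∈ (opMul A C).domain) (hx : x ∈ C.domain) (hCx : C ⟨x, hx⟩ ∈ A.domain) :
    opMul A C ⟨x, h⟩ = A ⟨C ⟨x, hx⟩, hCx⟩ :=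
  rfl

/-- The square `A² = A A`, with domain `{x ∈ D(A) | A x ∈ D(A)}`. -/
noncomputable def opSq {E : Type*} [AddCommGroup E] [Module ℂ E] (A : E →ₗ.[ℂ] E) :
    E →ₗ.[ℂ] E :=
  opMul A A

/-- `T` is `B`-linear: its domain is stable under the action of `B` and `T` commutes with it. -/
def IsModuleLinear (B : Type*) {E : Type*} [SMul B E] [AddCommGroup E] [Module ℂ E]
    (T : E →ₗ.[ℂ] E) : Prop :=
  ∀ (b : B) (x : E) (hx : x ∈ T.domain),
    ∃ hbx : b • x ∈ T.domain, T ⟨b • x, hbx⟩ = b • T ⟨x, hx⟩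

/-- `T` is self-adjoint: it is densely defined and `T = T*`. The second condition says that
`x ∈ D(T)` and `T x = z` if and only if `⟨x, T y⟩ = ⟨z, y⟩` for all `y ∈ D(T)`, the right-hand
side being the definition of `x ∈ D(T*)` and `T* x = z`. -/
structure IsSelfAdjointOp (B : Type*) {E : Type*} [Inner B E] [NormedAddCommGroup E]
    [NormedSpace ℂ E] (T : E →ₗ.[ℂ] E) : Prop where
  dense_domain : Dense (T.domain : Set E)
  mem_graph_iff : ∀ x z : E,
    (x, z) ∈ T.graph ↔ ∀ y : T.domain, inner B x (T y) = inner B z (y : E)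

/-- Regularity of a self-adjoint operator: for some non-real `z`, both `T + z` and `T - z` have
dense range. -/
def IsRegularOp {E : Type*} [NormedAddCommGroup E] [NormedSpace ℂ E] (T : E →ₗ.[ℂ] E) : Prop :=
  ∃ z : ℂ, z.im ≠ 0 ∧
    DenseRange (fun x : T.domain => T x + z • (x : E)) ∧
    DenseRange (fun x : T.domain => T x - z • (x : E))

/-- `T` is a self-adjoint and regular (`B`-linear) operator in the Hilbert `B`-module `E`. -/
structure IsSelfAdjointRegular (B : Type*) {E : Type*} [SMul B E] [Inner B E]
    [NormedAddCommGroup E] [NormedSpace ℂ E] (T : E →ₗ.[ℂ] E) : Prop where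
  moduleLinear : IsModuleLinear B T
  selfAdjoint : IsSelfAdjointOp B T
  regular : IsRegularOp T

/-- `F(S,T) = {x ∈ D(S) ∩ D(T) | S x ∈ D(T), T x ∈ D(S)}`. -/
def anticommDomain {E : Type*} [AddCommGroup E] [Module ℂ E] (S T : E →ₗ.[ℂ] E) : Set E :=
  {x | ∃ (hS : x ∈ S.domain) (hT : x ∈ T.domain), S ⟨x, hS⟩ ∈ T.domain ∧ T ⟨x, hT⟩ ∈ S.domain}

/-- The set `(S + z)⁻¹ (V)`, that is, all `x ∈ D(S)` with `S x + z x ∈ V`. For self-adjoint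
regular `S` and non-real `z` the map `S + z : D(S) → E` is bijective and this is the image of `V`
under the resolvent. -/
def resolventImage {E : Type*} [AddCommGroup E] [Module ℂ E] (S : E →ₗ.[ℂ] E) (z : ℂ)
    (V : Set E) : Set E :=
  {x | ∃ hx : x ∈ S.domain, S ⟨x, hx⟩ + z • x ∈ V}

/-- `(S, T)` is a weakly anticommuting pair of self-adjoint regular operators. -/
structure WeaklyAnticommuting (B : Type*) {E : Type*} [NonUnitalCStarAlgebra B] [PartialOrder B]
    [SMul B E] [Inner B E] [NormedAddCommGroup E] [NormedSpace ℂ E] (S T : E →ₗ.[ℂ] E) :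
    Prop where
  left : IsSelfAdjointRegular B S
  right : IsSelfAdjointRegular B T
  form_estimate : ∃ C₀ C₁ C₂ : ℝ, 0 < C₀ ∧ 0 < C₁ ∧ 0 < C₂ ∧
    ∀ (x : E) (hS : x ∈ S.domain) (hT : x ∈ T.domain)
      (hST : T ⟨x, hT⟩ ∈ S.domain) (hTS : S ⟨x, hS⟩ ∈ T.domain),
      inner B (S ⟨T ⟨x, hT⟩, hST⟩ + T ⟨S ⟨x, hS⟩, hTS⟩)
          (S ⟨T ⟨x, hT⟩, hST⟩ + T ⟨S ⟨x, hS⟩, hTS⟩) ≤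
        C₀ • inner B x x + C₁ • inner B (S ⟨x, hS⟩) (S ⟨x, hS⟩) +
          C₂ • inner B (T ⟨x, hT⟩) (T ⟨x, hT⟩)
  resolvent_core : ∃ V : Submodule ℂ E, T.HasCore V ∧
    ∃ l₀ : ℝ, 0 < l₀ ∧ ∀ t : ℝ, l₀ ≤ |t| →
      resolventImage S (t * Complex.I) (V : Set E) ⊆ anticommDomain S T

end HilbertModule

/-! Put D = S + T. On F(S,T) the anticommutator ST + TS is bounded by c(‖x‖ + ‖Sx‖ + ‖Tx‖), so it is
of first order, and S² + T² = D² − (ST + TS) should be a small perturbation of D². Three things have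
to be shown: D + z is onto for nonreal z, D(D²) lies in F(S,T), and the perturbation is a
contraction far from the real axis.

Closed submodules of a Hilbert module need not be complemented, so the arguments run on norms. If
⟨a,b⟩ + ⟨b,a⟩ is small, positivity bounds a and b by a + b. For a = Sx, b = Tx this mixed term
equals ⟨x,(ST+TS)x⟩ on F(S,T); resolvents of S carry the estimate over to D(S) ∩ D(T)
(`norm_mixed_le`, `norm_le_add`), and D is closed.

For the range of D + iτ, replace S by a bounded approximation S_m, solve (T + iτ + S_m)f = y, and
regularise f by Q_n = n²(S² + n²)⁻¹. As a function of S², Q_n nearly commutes with T, and (D +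
iτ)Q_n f misses y by at most ¾‖y‖. Riesz's lemma makes the range dense (`dense_range_add`).

If x ∈ D(D) and Dx ∈ D(S), the mixed-term estimate applied to Sx bounds STx a priori, and passing to
the limit in Q_n x gives x ∈ F(S,T) (`exists_antiRel_of_add_mem`). Finally (S² + T² − α²)(D² − α²)⁻¹
= 1 − K with ‖K‖ ≤ ½ (`exists_solution_sq`). For α on the diagonals α² is imaginary, which gives
self-adjointness and regularity; injectivity identifies the domains. -/

namespace HilbertModule

open Filter Topology Complex

set_option linter.unusedSectionVars false

/-! ### Symmetric linear relations: norm bounds, resolvents, surjectivity in half-planes. -/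

section Relations

variable (B : Type*) {E : Type*} [NonUnitalCStarAlgebra B] [PartialOrder B] [StarOrderedRing B]
  [NormedAddCommGroup E] [NormedSpace ℂ E] [SMul B E] [CStarModule B E]

open CStarModule in
/-- If the mixed terms of `⟨a + b, a + b⟩` are small, then `a` is controlled by `a + b`. -/
theorem norm_sq_le_of_mixed {a b : E} {q : ℝ} (h : ‖inner B a b + inner B b a‖ ≤ q) :
    ‖a‖ ^ 2 ≤ ‖a + b‖ ^ 2 + q := by
  have e : inner B (a + b) (a + b) - (inner B a b + inner B b a) =
      inner B a a + inner B b b := by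
    simp only [CStarModule.inner_add_left, CStarModule.inner_add_right]; abel
  calc ‖a‖ ^ 2 = ‖inner B a a‖ := norm_sq_eq B
    _ ≤ ‖inner B a a + inner B b b‖ :=
      CStarAlgebra.norm_le_norm_of_nonneg_of_le inner_self_nonneg
        (le_add_of_nonneg_right inner_self_nonneg)
    _ ≤ ‖inner B (a + b) (a + b)‖ + ‖inner B a b + inner B b a‖ := by
      rw [← e]; exact norm_sub_le _ _
    _ ≤ _ := by rw [← norm_sq_eq B]; gcongr

/-- A linear relation is symmetric with respect to the `B`-valued inner product. -/
def SymRel (G : Submodule ℂ (E × E)) : Prop :=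
  ∀ x u y v : E, (x, u) ∈ G → (y, v) ∈ G → inner B x v = inner B u y

/-- The relation `G + z` is surjective. -/
def Solvable (G : Submodule ℂ (E × E)) (z : ℂ) : Prop :=
  ∀ y, ∃ x, (x, y - z • x) ∈ G

variable {B} {G : Submodule ℂ (E × E)}

-- By symmetry the real and imaginary parts of u + zx have cancelling mixed terms, so each is
-- bounded by the whole.
open CStarModule in
theorem SymRel.mixed (hG : SymRel B G) (z : ℂ) {x u : E} (h : (x, u) ∈ G) :
    inner B (u + (z.re : ℂ) • x) ((z.im * I) • x) +
      inner B ((z.im * I) • x) (u + (z.re : ℂ) • x) = 0 := by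
  have h1 := hG x u x u h h
  simp only [inner_smul_right_complex, inner_smul_left_complex,
    CStarModule.inner_add_left, CStarModule.inner_add_right, h1, RCLike.star_def, map_mul,
    conj_ofReal, conj_I]
  module

theorem SymRel.norm_re_le (hG : SymRel B G) (z : ℂ) {x u : E} (h : (x, u) ∈ G) :
    ‖u + (z.re : ℂ) • x‖ ≤ ‖u + z • x‖ := by
  have := norm_sq_le_of_mixed B (q := 0) (by rw [hG.mixed z h, norm_zero])
  rw [add_assoc, ← add_smul, re_add_im, add_zero] at this
  exact le_of_sq_le_sq this (norm_nonneg _)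

theorem SymRel.norm_im_le (hG : SymRel B G) (z : ℂ) {x u : E} (h : (x, u) ∈ G) :
    |z.im| * ‖x‖ ≤ ‖u + z • x‖ := by
  have := norm_sq_le_of_mixed B (q := 0) (by rw [add_comm, hG.mixed z h, norm_zero])
  rw [add_comm (_ • _), add_assoc, ← add_smul, re_add_im, add_zero] at this
  have := le_of_sq_le_sq this (norm_nonneg _)
  simpa [norm_smul] using this

theorem SymRel.exists_resolvent (hG : SymRel B G) {z : ℂ} (hz : z.im ≠ 0) (hs : Solvable G z) :
    ∃ R : E →L[ℂ] E, (∀ y, (R y, y - z • R y) ∈ G) ∧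
      (∀ x u, (x, u) ∈ G → R (u + z • x) = x) ∧ ∀ y, |z.im| * ‖R y‖ ≤ ‖y‖ := by
  have uniq : ∀ x x' y : E, (x, y - z • x) ∈ G → (x', y - z • x') ∈ G → x = x' := by
    intro x x' y h h'
    have h1 := hG.norm_im_le z (G.sub_mem h h')
    rw [show (x, y - z • x).2 - (x', y - z • x').2 + z • ((x, y - z • x).1 - (x', y - z • x').1)
      = 0 by simp [smul_sub]] at h1
    have h2 : |z.im| * ‖x - x'‖ ≤ 0 := by simpa using h1
    have h3 : 0 < |z.im| := abs_pos.mpr hz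
    have h4 : ‖x - x'‖ ≤ 0 := by nlinarith [norm_nonneg (x - x')]
    exact sub_eq_zero.mp (norm_le_zero_iff.mp h4)
  choose R hR using hs
  have bd : ∀ y, |z.im| * ‖R y‖ ≤ ‖y‖ := fun y => by
    simpa using hG.norm_im_le z (hR y)
  let L : E →ₗ[ℂ] E :=
    { toFun := R
      map_add' := fun y y' => by
        refine uniq _ _ (y + y') (hR _) ?_
        convert G.add_mem (hR y) (hR y') using 1
        ext <;> simp [smul_add]; abel
      map_smul' := fun c y => by
        refine uniq _ _ (c • y) (hR _) ?_
        convert G.smul_mem c (hR y) using 1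
        ext <;> simp [smul_sub, smul_smul, mul_comm] }
  refine ⟨L.mkContinuous |z.im|⁻¹ fun y => ?_, hR, fun x u h => ?_, bd⟩
  · rw [inv_mul_eq_div, le_div_iff₀ (abs_pos.mpr hz), mul_comm]; exact bd y
  · exact uniq _ _ _ (hR _) (by simpa using h)

/-- A strict contraction `L` makes `h ↦ h + L h` surjective. -/
theorem exists_add_apply_eq [CompleteSpace E] (L : E →L[ℂ] E) {c : ℝ} (hc : c < 1) (hc0 : 0 ≤ c)
    (hL : ∀ y, ‖L y‖ ≤ c * ‖y‖) (y : E) : ∃ h, h + L h = y := by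
  have h1 : ‖-L‖ < 1 := by
    rw [norm_neg]; exact (L.opNorm_le_bound hc0 hL).trans_lt hc
  refine ⟨(↑(Units.oneSub (-L) h1)⁻¹ : E →L[ℂ] E) y, ?_⟩
  have := congrArg (fun f : E →L[ℂ] E => f y) (Units.oneSub (-L) h1).mul_inv
  simpa using this

/-- Neumann series: with R = (G + z)⁻¹, ‖MR‖ ≤ ‖M‖/|Im z| < 1, and x = Rh for the solution of h +
MRh = y. -/
theorem SymRel.solvable_perturb [CompleteSpace E] (hG : SymRel B G) {z : ℂ} (hs : Solvable G z)
    (M : E →L[ℂ] E) (hM : ‖M‖ < |z.im|) (y : E) : ∃ x, (x, y - z • x - M x) ∈ G := by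
  have hz : 0 < |z.im| := (norm_nonneg _).trans_lt hM
  obtain ⟨R, hR, -, bd⟩ := hG.exists_resolvent (abs_pos.mp hz) hs
  obtain ⟨h, rfl⟩ := exists_add_apply_eq (M ∘L R) (c := ‖M‖ / |z.im|) ((div_lt_one hz).mpr hM)
    (by positivity) (fun y => by
      rw [div_mul_eq_mul_div, mul_div_assoc]
      refine (M.le_opNorm _).trans ?_
      gcongr
      rw [le_div_iff₀ hz, mul_comm]; exact bd y) y
  refine ⟨R h, ?_⟩
  convert hR h using 2
  simp; abel

/-- Surjectivity of `G + z` propagates through the half-plane containing `z`. -/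
theorem SymRel.solvable_of_im_mul_pos [CompleteSpace E] (hG : SymRel B G) {z w : ℂ}
    (hs : Solvable G z) (hzw : 0 < z.im * w.im) : Solvable G w := by
  have step : ∀ a b : ℂ, Solvable G a → ‖b - a‖ < |a.im| → Solvable G b := by
    intro a b ha hab y
    obtain ⟨x, hx⟩ := hG.solvable_perturb ha ((b - a) • ContinuousLinearMap.id ℂ E)
      (by
        rw [norm_smul]
        exact (mul_le_of_le_one_right (norm_nonneg _) ContinuousLinearMap.norm_id_le).trans_lt hab)
      y
    refine ⟨x, ?_⟩
    convert hx using 2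
    simp [sub_smul]
  -- The half-plane is connected, and solvable and unsolvable points each form an open set.
  set H : Set ℂ := {a | 0 < z.im * a.im} with hH
  have hconv : Convex ℝ H := by
    intro a ha b hb s t hs ht hst
    simp only [hH, Set.mem_ofPred_eq, add_im, real_smul, mul_im, ofReal_re, ofReal_im, zero_mul,
      add_zero] at *
    rcases hs.eq_or_lt with rfl | hs
    · obtain rfl : t = 1 := by linarith
      simpa using hb
    · nlinarith [mul_pos hs ha, mul_nonneg ht hb.le]
  have hz0 : z.im ≠ 0 := fun h => by simp [h] at hzw
  have hH0 : ∀ a ∈ H, a.im ≠ 0 := fun a ha h => by simp [hH, h] at ha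
  by_contra hw
  obtain ⟨a, -, ⟨-, ha⟩, ⟨-, ha'⟩⟩ := hconv.isPreconnected
    {a | a.im ≠ 0 ∧ Solvable G a} {a | a.im ≠ 0 ∧ ¬ Solvable G a}
    (by
      rw [Metric.isOpen_iff]
      rintro a ⟨ha0, ha⟩
      refine ⟨|a.im|, abs_pos.mpr ha0, fun b hb => ?_⟩
      rw [Metric.mem_ball, dist_eq_norm] at hb
      refine ⟨fun h => ?_, step a b ha hb⟩
      have := (abs_im_le_norm (b - a)).trans_lt hb
      simp [h] at this)
    (by
      rw [Metric.isOpen_iff]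
      rintro a ⟨ha0, ha⟩
      -- The radius is halved because the step now goes from b back to a and needs ‖a − b‖ < |Im b|.
      refine ⟨|a.im| / 2, half_pos (abs_pos.mpr ha0), fun b hb => ?_⟩
      rw [Metric.mem_ball, dist_eq_norm] at hb
      have h1 := (abs_im_le_norm (b - a)).trans_lt hb
      rw [sub_im, abs_sub_comm] at h1
      have h2 := abs_sub_abs_le_abs_sub a.im b.im
      have h3 : |a.im| / 2 < |b.im| := by linarith
      have h4 := abs_pos.mpr ha0
      refine ⟨abs_pos.mp (by linarith), fun h => ha (step b a h ?_)⟩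
      rw [norm_sub_rev]; linarith)
    (fun a ha => by
      by_cases h : Solvable G a
      · exact Or.inl ⟨hH0 a ha, h⟩
      · exact Or.inr ⟨hH0 a ha, h⟩)
    ⟨z, by simpa [hH] using mul_self_pos.mpr hz0, hz0, hs⟩ ⟨w, hzw, hH0 w hzw, hw⟩
  exact ha' ha

theorem SymRel.solvable [CompleteSpace E] (hG : SymRel B G) {z₀ : ℂ} (hz₀ : z₀.im ≠ 0)
    (h : Solvable G z₀) (h' : Solvable G (-z₀)) {z : ℂ} (hz : z.im ≠ 0) :
    Solvable G z := by
  rcases (mul_ne_zero hz₀ hz).lt_or_gt with h0 | h0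
  · refine hG.solvable_of_im_mul_pos h' ?_
    simpa using h0
  · refine hG.solvable_of_im_mul_pos h ?_
    simpa using h0

/-- A closed symmetric relation with dense range of `G + z` has `G + z` surjective. -/
theorem SymRel.solvable_of_dense [CompleteSpace E] (hG : SymRel B G)
    (hc : IsClosed (G : Set (E × E))) {z : ℂ} (hz : z.im ≠ 0)
    (hd : Dense {y : E | ∃ x u, (x, u) ∈ G ∧ u + z • x = y}) : Solvable G z := by
  intro y
  obtain ⟨f, hf, hlim⟩ := mem_closure_iff_seq_limit.mp (hd y)
  choose x u hxu hfx using hf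
  have hx : CauchySeq x := by
    have hcf := hlim.cauchySeq
    rw [Metric.cauchySeq_iff] at hcf ⊢
    intro ε hε
    obtain ⟨N, hN⟩ := hcf (ε * |z.im|) (mul_pos hε (abs_pos.mpr hz))
    refine ⟨N, fun m hm n hn => ?_⟩
    have h1 := hN m hm n hn
    have h2 := hG.norm_im_le z (G.sub_mem (hxu m) (hxu n))
    rw [dist_eq_norm] at h1 ⊢
    have h3 : u m - u n + z • (x m - x n) = f m - f n := by
      rw [← hfx, ← hfx, smul_sub]; abel
    simp only [h3] at h2
    have h4 : |z.im| * ‖x m - x n‖ < |z.im| * ε := by linarith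
    exact lt_of_mul_lt_mul_left h4 (abs_nonneg _)
  obtain ⟨x0, hx0⟩ := cauchySeq_tendsto_of_complete hx
  refine ⟨x0, hc.mem_of_tendsto (hx0.prodMk_nhds (hlim.sub (hx0.const_smul z)))
    (Eventually.of_forall fun n => ?_)⟩
  simpa [← hfx] using hxu n

/-- A subspace which approximates every vector up to a fixed factor `c < 1` is dense. -/
theorem dense_of_approx (W : Submodule ℂ E) {c : ℝ} (hc : c < 1)
    (h : ∀ y, ∃ w ∈ W, ‖y - w‖ ≤ c * ‖y‖) : Dense (W : Set E) := by
  by_contra hne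
  obtain ⟨x, hx⟩ : ∃ x, x ∉ W.topologicalClosure := by
    by_contra! hall
    exact hne (Submodule.dense_iff_topologicalClosure_eq_top.mpr (Submodule.eq_top_iff'.mpr hall))
  -- Riesz's lemma with c < r < 1 yields x0 at distance at least r‖x0‖ from the closure of W,
  -- against the approximation within c‖x0‖.
  obtain ⟨r, hr, hr1⟩ := exists_between (max_lt hc zero_lt_one)
  obtain ⟨x0, hx0, hle⟩ := riesz_lemma W.isClosed_topologicalClosure ⟨x, hx⟩ hr1
  obtain ⟨w, hw, hw2⟩ := h x0
  have h1 := hle w (W.le_topologicalClosure hw)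
  have h2 : 0 < ‖x0‖ := norm_pos_iff.mpr fun h0 => hx0 (h0 ▸ Submodule.zero_mem _)
  have h3 : c < r := (le_max_left _ _).trans_lt hr
  nlinarith

end Relations

/-! ### Imaginary resolvents of one operator and the regularisations built from them. -/

section Resolvents

variable {B : Type*} {E : Type*} [NonUnitalCStarAlgebra B] [PartialOrder B] [StarOrderedRing B]
  [NormedAddCommGroup E] [NormedSpace ℂ E] [SMul B E] [CStarModule B E]

/-- `R t = (A + it)⁻¹` for all real `t ≠ 0`, with the usual norm bounds. -/
structure ImResolvent (A : E →ₗ.[ℂ] E) (R : ℝ → E →L[ℂ] E) : Prop where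
  mem : ∀ {t : ℝ}, t ≠ 0 → ∀ y, (R t y, y - (t * I) • R t y) ∈ A.graph
  left_inv : ∀ {t : ℝ}, t ≠ 0 → ∀ {x u}, (x, u) ∈ A.graph → R t (u + (t * I) • x) = x
  norm_le : ∀ {t : ℝ}, t ≠ 0 → ∀ y, ‖R t y‖ ≤ ‖y‖ / |t|
  norm_sub_le : ∀ {t : ℝ}, t ≠ 0 → ∀ y, ‖y - (t * I) • R t y‖ ≤ ‖y‖

theorem SymRel.exists_imResolvent {A : E →ₗ.[ℂ] E} (hA : SymRel B A.graph)
    (hs : ∀ z : ℂ, z.im ≠ 0 → Solvable A.graph z) : ∃ R, ImResolvent A R := by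
  have h : ∀ t : ℝ, ∃ R : E →L[ℂ] E, t ≠ 0 → (∀ y, (R y, y - (t * I) • R y) ∈ A.graph) ∧
      (∀ x u, (x, u) ∈ A.graph → R (u + (t * I) • x) = x) ∧ ∀ y, |t| * ‖R y‖ ≤ ‖y‖ := by
    intro t
    by_cases ht : t = 0
    · exact ⟨0, fun h => (h ht).elim⟩
    · have ht' : ((t : ℂ) * I).im ≠ 0 := by simpa using ht
      obtain ⟨R, h1, h2, h3⟩ := hA.exists_resolvent ht' (hs _ ht')
      exact ⟨R, fun _ => ⟨h1, h2, by simpa using h3⟩⟩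
  choose R hR using h
  refine ⟨R, fun ht => (hR _ ht).1, fun ht => (hR _ ht).2.1 _ _, fun ht y => ?_, fun {t} ht y => ?_⟩
  · rw [le_div_iff₀ (abs_pos.mpr ht), mul_comm]; exact (hR _ ht).2.2 y
  · simpa using hA.norm_re_le (t * I) ((hR _ ht).1 y)

namespace ImResolvent

variable {A : E →ₗ.[ℂ] E} {R : ℝ → E →L[ℂ] E} (hR : ImResolvent A R)

include hR

theorem apply_sub {t : ℝ} (ht : t ≠ 0) {x u : E} (h : (x, u) ∈ A.graph) :
    x - (t * I) • R t x = R t u := by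
  have := hR.left_inv ht h
  rw [map_add, map_smul] at this
  exact sub_eq_of_eq_add this.symm

theorem map {t : ℝ} (ht : t ≠ 0) {x u : E} (h : (x, u) ∈ A.graph) :
    (R t x, R t u) ∈ A.graph := by
  rw [← hR.apply_sub ht h]; exact hR.mem ht x

theorem sub_comm {s t : ℝ} (hs : s ≠ 0) (ht : t ≠ 0) (y : E) :
    R s (y - (t * I) • R t y) = R t y - (s * I) • R s (R t y) :=
  (hR.apply_sub hs (hR.mem ht y)).symm

/-- The vector is A(A + it)⁻¹h. These operators are contractions, and on D(A) they equal (A + it)⁻¹A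
= O(1/|t|). The argument h may vary with n, as later applications require. -/
theorem tendsto_sub (hd : Dense (A.domain : Set E)) {t : ℕ → ℝ} (ht0 : ∀ n, t n ≠ 0)
    (ht : Tendsto (fun n => |t n|) atTop atTop) {h : ℕ → E} {a : E} (hh : Tendsto h atTop (𝓝 a)) :
    Tendsto (fun n => h n - (t n * I) • R (t n) (h n)) atTop (𝓝 0) := by
  rw [Metric.tendsto_atTop]
  intro ε hε
  obtain ⟨x, hx, hxa⟩ := Metric.dense_iff.mp hd a (ε / 3) (by positivity)
  obtain ⟨u, hu⟩ := LinearPMap.mem_domain_iff.mp hxa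
  rw [Metric.mem_ball, dist_comm, dist_eq_norm] at hx
  obtain ⟨N1, hN1⟩ := Metric.tendsto_atTop.mp hh (ε / 3) (by positivity)
  obtain ⟨N2, hN2⟩ := (tendsto_atTop.mp ht (3 * (‖u‖ + 1) / ε)).exists_forall_of_atTop
  refine ⟨max N1 N2, fun n hn => ?_⟩
  have h1 := hN1 n ((le_max_left _ _).trans hn)
  have h2 := hN2 n ((le_max_right _ _).trans hn)
  rw [dist_eq_norm] at h1
  have h3 : ‖R (t n) u‖ < ε / 3 := by
    refine (hR.norm_le (ht0 n) u).trans_lt ?_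
    rw [div_lt_iff₀ (abs_pos.mpr (ht0 n))]
    rw [div_le_iff₀ hε] at h2
    nlinarith
  have h4 := hR.norm_sub_le (ht0 n) (h n - x)
  have h5 : ‖h n - x‖ ≤ ‖h n - a‖ + ‖a - x‖ := norm_sub_le_norm_sub_add_norm_sub _ _ _
  have h6 : h n - (t n * I) • R (t n) (h n) =
      (h n - x - (t n * I) • R (t n) (h n - x)) + R (t n) u := by
    rw [← hR.apply_sub (ht0 n) hu, map_sub, smul_sub]; abel
  rw [dist_zero_right, h6]
  exact (norm_add_le _ _).trans_lt (by linarith)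

theorem tendsto_smul (hd : Dense (A.domain : Set E)) {t : ℕ → ℝ} (ht0 : ∀ n, t n ≠ 0)
    (ht : Tendsto (fun n => |t n|) atTop atTop) {h : ℕ → E} {a : E} (hh : Tendsto h atTop (𝓝 a)) :
    Tendsto (fun n => (t n * I) • R (t n) (h n)) atTop (𝓝 a) := by
  simpa using hh.sub (hR.tendsto_sub hd ht0 ht hh)

end ImResolvent

/-- The regularisation `t² (A² + t²)⁻¹`, expressed through the resolvents. -/
noncomputable def smoothing (R : ℝ → E →L[ℂ] E) (t : ℝ) : E →L[ℂ] E :=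
  (t * I / 2) • (R t - R (-t))

/-- The bounded approximation `t² A (A² + t²)⁻¹` of `A`, expressed through the resolvents. -/
noncomputable def boundedApprox (R : ℝ → E →L[ℂ] E) (t : ℝ) : E →L[ℂ] E :=
  ((t : ℂ) ^ 2 / 2) • (R t + R (-t))

theorem smoothing_apply (R : ℝ → E →L[ℂ] E) (t : ℝ) (y : E) :
    smoothing R t y = (1 / 2 : ℂ) • ((t * I) • R t y + ((-t : ℝ) * I) • R (-t) y) := by
  simp only [smoothing, smul_apply, sub_apply, ofReal_neg]
  module

theorem sub_smoothing_apply (R : ℝ → E →L[ℂ] E) (t : ℝ) (y : E) :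
    y - smoothing R t y =
      (1 / 2 : ℂ) • ((y - (t * I) • R t y) + (y - ((-t : ℝ) * I) • R (-t) y)) := by
  rw [smoothing_apply]; module

namespace ImResolvent

variable {A : E →ₗ.[ℂ] E} {R : ℝ → E →L[ℂ] E} (hR : ImResolvent A R)

include hR

theorem norm_smul_le {t : ℝ} (ht : t ≠ 0) (y : E) : ‖(t * I) • R t y‖ ≤ ‖y‖ := by
  have h := hR.norm_le ht y
  rw [le_div_iff₀ (abs_pos.mpr ht)] at h
  simpa [norm_smul, mul_comm] using h

theorem norm_smoothing_le {t : ℝ} (ht : t ≠ 0) (y : E) : ‖smoothing R t y‖ ≤ ‖y‖ := by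
  rw [smoothing_apply, norm_smul]
  have := norm_add_le ((t * I) • R t y) (((-t : ℝ) * I) • R (-t) y)
  have h1 := hR.norm_smul_le ht y
  have h2 := hR.norm_smul_le (neg_ne_zero.mpr ht) y
  norm_num at *
  linarith

theorem smoothing_mem {t : ℝ} (ht : t ≠ 0) (y : E) :
    (smoothing R t y, boundedApprox R t y) ∈ A.graph := by
  convert A.graph.smul_mem (t * I / 2) (A.graph.sub_mem (hR.mem ht y)
    (hR.mem (neg_ne_zero.mpr ht) y)) using 1
  refine Prod.ext (by simp [smoothing]) ?_
  simp only [boundedApprox, smul_apply, add_apply,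
    Prod.mk_sub_mk, Prod.smul_mk, ofReal_neg]
  have : (t : ℂ) ^ 2 / 2 = -((t * I / 2) * (t * I)) := by
    ring_nf; rw [I_sq]; ring
  rw [this]; module

theorem smoothing_map {t : ℝ} (ht : t ≠ 0) {x u : E} (h : (x, u) ∈ A.graph) :
    (smoothing R t x, smoothing R t u) ∈ A.graph :=
  A.graph.smul_mem (t * I / 2) (A.graph.sub_mem (hR.map ht h) (hR.map (neg_ne_zero.mpr ht) h))

theorem tendsto_smoothing (hd : Dense (A.domain : Set E)) {t : ℕ → ℝ} (ht0 : ∀ n, t n ≠ 0)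
    (ht : Tendsto (fun n => |t n|) atTop atTop) (a : E) :
    Tendsto (fun n => smoothing R (t n) a) atTop (𝓝 a) := by
  simp only [smoothing_apply]
  have h1 := hR.tendsto_smul hd ht0 ht (tendsto_const_nhds (x := a))
  have h2 := hR.tendsto_smul hd (fun n => neg_ne_zero.mpr (ht0 n)) (by simpa using ht)
    (tendsto_const_nhds (x := a))
  have := (h1.add h2).const_smul (1 / 2 : ℂ)
  rwa [show (1 / 2 : ℂ) • (a + a) = a by module] at this

theorem inner_apply_left (hA : SymRel B A.graph) {t : ℝ} (ht : t ≠ 0) (x y : E) :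
    inner B (R t x) y = inner B x (R (-t) y) := by
  have := hA _ _ _ _ (hR.mem ht x) (hR.mem (neg_ne_zero.mpr ht) y)
  simp only [CStarModule.inner_sub_left, CStarModule.inner_sub_right,
    CStarModule.inner_smul_right_complex, CStarModule.inner_smul_left_complex, RCLike.star_def,
    map_mul, conj_ofReal, conj_I, ofReal_neg, neg_mul, mul_neg] at this
  exact sub_left_injective this

theorem inner_boundedApprox (hA : SymRel B A.graph) {t : ℝ} (ht : t ≠ 0) (x y : E) :
    inner B (boundedApprox R t x) y = inner B x (boundedApprox R t y) := by
  have h1 := hR.inner_apply_left hA ht x y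
  have h2 := hR.inner_apply_left hA (neg_ne_zero.mpr ht) x y
  rw [neg_neg] at h2
  simp only [boundedApprox, smul_apply, add_apply,
    CStarModule.inner_smul_right_complex, CStarModule.inner_smul_left_complex,
    CStarModule.inner_add_left, CStarModule.inner_add_right, h1, h2]
  rw [add_comm (inner B x _)]
  simp

/-- 1 − `smoothing` is the mean of A(A ± it)⁻¹. Moving A onto the resolvent at s leaves a
contraction times (A ± it)⁻¹, of norm at most 1/|t|. -/
theorem norm_apply_sub_smoothing_le {s t : ℝ} (hs : s ≠ 0) (ht : t ≠ 0) (y : E) :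
    ‖R s (y - smoothing R t y)‖ ≤ ‖y‖ / |t| := by
  have key : ∀ r : ℝ, r ≠ 0 → ‖R s (y - (r * I) • R r y)‖ ≤ ‖y‖ / |r| := fun r hr => by
    rw [hR.sub_comm hs hr]
    exact (hR.norm_sub_le hs _).trans (hR.norm_le hr y)
  have h1 := key t ht
  have h2 := key (-t) (neg_ne_zero.mpr ht)
  rw [abs_neg] at h2
  rw [sub_smoothing_apply, map_smul, map_add, norm_smul]
  have := norm_add_le (R s (y - (t * I) • R t y)) (R s (y - ((-t : ℝ) * I) • R (-t) y))
  norm_num at *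
  linarith

/-- Functions of A commute, so the difference is `boundedApprox R s` applied to y − `smoothing R t
y`. For fixed s it vanishes as |t| → ∞. -/
theorem norm_boundedApprox_sub_le {s t : ℝ} (hs : s ≠ 0) (ht : t ≠ 0) (y : E) :
    ‖boundedApprox R s y - smoothing R s (boundedApprox R t y)‖ ≤ s ^ 2 / |t| * ‖y‖ := by
  have h0 : smoothing R s (boundedApprox R t y) = boundedApprox R s (smoothing R t y) :=
    A.mem_graph_snd_inj (hR.smoothing_map hs (hR.smoothing_mem ht y))
      (hR.smoothing_mem hs (smoothing R t y)) rfl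
  have h1 := hR.norm_apply_sub_smoothing_le hs ht y
  have h2 := hR.norm_apply_sub_smoothing_le (neg_ne_zero.mpr hs) ht y
  rw [h0, ← map_sub]
  simp only [boundedApprox, smul_apply, add_apply,
    norm_smul]
  have h3 : ‖(s : ℂ) ^ 2 / 2‖ = s ^ 2 / 2 := by simp
  rw [h3]
  calc _ ≤ s ^ 2 / 2 * (‖y‖ / |t| + ‖y‖ / |t|) := by
        gcongr; exact (norm_add_le _ _).trans (add_le_add h1 h2)
    _ = s ^ 2 / |t| * ‖y‖ := by ring

end ImResolvent

end Resolvents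

theorem cauchySeq_of_norm_sub_le {E F : Type*} [NormedAddCommGroup E] [NormedAddCommGroup F]
    {a g h : ℕ → E} {f : ℕ → F} (C : ℝ)
    (hC : 0 ≤ C) (hf : CauchySeq f) (hg : CauchySeq g) (hh : CauchySeq h)
    (H : ∀ n m, ‖a n - a m‖ ≤ C * (‖f n - f m‖ + ‖g n - g m‖ + ‖h n - h m‖)) : CauchySeq a := by
  rw [Metric.cauchySeq_iff] at *
  intro ε hε
  have hδ : 0 < ε / (3 * (C + 1)) := by positivity
  obtain ⟨N1, h1⟩ := hf _ hδ
  obtain ⟨N2, h2⟩ := hg _ hδ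
  obtain ⟨N3, h3⟩ := hh _ hδ
  refine ⟨max N1 (max N2 N3), fun n hn m hm => ?_⟩
  simp only [ge_iff_le, max_le_iff] at hn hm
  have k1 := h1 n hn.1 m hm.1
  have k2 := h2 n hn.2.1 m hm.2.1
  have k3 := h3 n hn.2.2 m hm.2.2
  rw [dist_eq_norm] at *
  have : ‖f n - f m‖ + ‖g n - g m‖ + ‖h n - h m‖ < ε / (C + 1) := by
    calc _ < ε / (3 * (C + 1)) + ε / (3 * (C + 1)) + ε / (3 * (C + 1)) := by linarith
      _ = ε / (C + 1) := by field_simp; norm_num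
  rw [lt_div_iff₀ (by positivity)] at this
  have h0 : 0 ≤ ‖f n - f m‖ + ‖g n - g m‖ + ‖h n - h m‖ := by positivity
  linarith [H n m]

/-- The larger of U and W satisfies a quadratic inequality; completing the square absorbs its linear
term. -/
theorem le_of_sq_le_add_mul {U W d x c : ℝ} (hd : 0 ≤ d) (hx : 0 ≤ x) (hc : 0 ≤ c)
    (hU : U ^ 2 ≤ d ^ 2 + c * x * (x + U + W)) (hW : W ^ 2 ≤ d ^ 2 + c * x * (x + U + W)) :
    U ≤ d + (2 * c + 1) * x ∧ W ≤ d + (2 * c + 1) * x := by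
  have key : ∀ N, N ^ 2 ≤ d ^ 2 + c * x * (x + 2 * N) → N ≤ d + (2 * c + 1) * x := by
    intro N hN
    have h1 : (N - c * x) ^ 2 ≤ (d + (c + 1) * x) ^ 2 := by
      nlinarith [mul_nonneg hd hx, mul_nonneg hc hx, mul_nonneg (mul_nonneg hc hx) hd,
        mul_nonneg (mul_nonneg hc hx) hx, sq_nonneg x]
    have := le_of_sq_le_sq h1 (by positivity)
    linarith
  have hcx := mul_nonneg hc hx
  rcases le_total U W with h | h
  · have := key W (by nlinarith)
    exact ⟨h.trans this, this⟩
  · have := key U (by nlinarith)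
    exact ⟨this, h.trans this⟩

/-! ### Anticommuting pairs: commutation with resolvents and the mixed-term estimate. -/

section Pairs

variable {B : Type*} {E : Type*} [NonUnitalCStarAlgebra B] [PartialOrder B] [StarOrderedRing B]
  [NormedAddCommGroup E] [NormedSpace ℂ E] [SMul B E] [CStarModule B E]

/-- `x ∈ F(S,T)` with `S x = u`, `T x = v` and `(ST + TS) x = k`. -/
def AntiRel (S T : E →ₗ.[ℂ] E) (x u v k : E) : Prop :=
  (x, u) ∈ S.graph ∧ (x, v) ∈ T.graph ∧
    ∃ p q, (u, p) ∈ T.graph ∧ (v, q) ∈ S.graph ∧ k = p + q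

theorem AntiRel.sub {S T : E →ₗ.[ℂ] E} {x u v k x' u' v' k' : E} (h : AntiRel S T x u v k)
    (h' : AntiRel S T x' u' v' k') : AntiRel S T (x - x') (u - u') (v - v') (k - k') := by
  obtain ⟨h1, h2, p, q, h3, h4, rfl⟩ := h
  obtain ⟨h1', h2', p', q', h3', h4', rfl⟩ := h'
  exact ⟨S.graph.sub_mem h1 h1', T.graph.sub_mem h2 h2', p - p', q - q',
    T.graph.sub_mem h3 h3', S.graph.sub_mem h4 h4', by abel⟩

theorem AntiRel.add {S T : E →ₗ.[ℂ] E} {x u v k x' u' v' k' : E} (h : AntiRel S T x u v k)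
    (h' : AntiRel S T x' u' v' k') : AntiRel S T (x + x') (u + u') (v + v') (k + k') := by
  obtain ⟨h1, h2, p, q, h3, h4, rfl⟩ := h
  obtain ⟨h1', h2', p', q', h3', h4', rfl⟩ := h'
  exact ⟨S.graph.add_mem h1 h1', T.graph.add_mem h2 h2', p + p', q + q',
    T.graph.add_mem h3 h3', S.graph.add_mem h4 h4', by abel⟩

theorem AntiRel.unique {S T : E →ₗ.[ℂ] E} {x u v k u' v' k' : E} (h : AntiRel S T x u v k)
    (h' : AntiRel S T x u' v' k') : k = k' := by
  obtain ⟨h1, h2, p, q, h3, h4, rfl⟩ := h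
  obtain ⟨h1', h2', p', q', h3', h4', rfl⟩ := h'
  obtain rfl := S.mem_graph_snd_inj h1 h1' rfl
  obtain rfl := T.mem_graph_snd_inj h2 h2' rfl
  rw [S.mem_graph_snd_inj h4 h4' rfl, T.mem_graph_snd_inj h3 h3' rfl]

theorem AntiRel.smul {S T : E →ₗ.[ℂ] E} {x u v k : E} (a : ℂ) (h : AntiRel S T x u v k) :
    AntiRel S T (a • x) (a • u) (a • v) (a • k) := by
  obtain ⟨h1, h2, p, q, h3, h4, rfl⟩ := h
  exact ⟨S.graph.smul_mem a h1, T.graph.smul_mem a h2, a • p, a • q,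
    T.graph.smul_mem a h3, S.graph.smul_mem a h4, smul_add _ _ _⟩

theorem AntiRel.snd_mem {S T : E →ₗ.[ℂ] E} {x u v k q : E} (h : AntiRel S T x u v k)
    (hq : (v, q) ∈ S.graph) : (u, k - q) ∈ T.graph := by
  obtain ⟨-, -, p, q', h3, h4, rfl⟩ := h
  rw [S.mem_graph_snd_inj hq h4 rfl]
  simpa using h3

variable (B) in
/-- The working form of a weakly anticommuting pair: `R t = (S + it)⁻¹`, and the anticommutator
is bounded with constant `c`. -/
structure AnticommPair (S T : E →ₗ.[ℂ] E) (R : ℝ → E →L[ℂ] E) (c : ℝ) : Prop where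
  symS : SymRel B S.graph
  symT : SymRel B T.graph
  closedS : IsClosed (S.graph : Set (E × E))
  closedT : IsClosed (T.graph : Set (E × E))
  denseS : Dense (S.domain : Set E)
  denseT : Dense (T.domain : Set E)
  solvableT : ∀ z : ℂ, z.im ≠ 0 → Solvable T.graph z
  res : ImResolvent S R
  pos : 0 < c
  bound : ∀ {x u v k : E}, AntiRel S T x u v k → ‖k‖ ≤ c * (‖x‖ + ‖u‖ + ‖v‖)
  core : ∃ V : Submodule ℂ E,
    (∀ x w, (x, w) ∈ T.graph → ∃ f : ℕ → E × E, (∀ n, (f n).1 ∈ V ∧ f n ∈ T.graph) ∧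
      Tendsto f atTop (𝓝 (x, w))) ∧
    ∃ l₀ : ℝ, 0 < l₀ ∧ ∀ t : ℝ, l₀ ≤ |t| → ∀ x ∈ V,
      ∃ v k, AntiRel S T (R t x) (x - (t * I) • R t x) v k

/-- `R t x ∈ F(S,T)` for `x` with `T x = w`, where `T (R t x) = v` is given by the commutation
formula and `k = (ST + TS) (R t x)`. -/
def ResRel (S T : E →ₗ.[ℂ] E) (R : ℝ → E →L[ℂ] E) (t : ℝ) (x w v k : E) : Prop :=
  AntiRel S T (R t x) (x - (t * I) • R t x) v k ∧ v = R (-t) (k - w)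

theorem ResRel.sub {S T : E →ₗ.[ℂ] E} {R : ℝ → E →L[ℂ] E} {t : ℝ} {x w v k x' w' v' k' : E}
    (h : ResRel S T R t x w v k) (h' : ResRel S T R t x' w' v' k') :
    ResRel S T R t (x - x') (w - w') (v - v') (k - k') := by
  refine ⟨?_, ?_⟩
  · convert h.1.sub h'.1 using 1
    · simp
    · simp only [map_sub]; module
  · rw [h.2, h'.2, ← map_sub]; congr 1; abel

namespace AnticommPair

variable {S T : E →ₗ.[ℂ] E} {R : ℝ → E →L[ℂ] E} {c : ℝ} (P : AnticommPair B S T R c)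

include P

/-- The bound on k involves v = R(−t)(k − w), hence k again, but with factor c/|t| ≤ ½, which is
absorbed on the left. -/
theorem norm_le_of_resRel {t : ℝ} (ht : 2 * c ≤ |t|) {x w v k : E}
    (h : ResRel S T R t x w v k) :
    ‖k‖ ≤ 2 * c * (‖R t x‖ + ‖x - (t * I) • R t x‖ + ‖R (-t) w‖) := by
  have hc := P.pos
  have ht0 : t ≠ 0 := abs_pos.mp (by linarith)
  have h1 := P.bound h.1
  have h2 : ‖v‖ ≤ ‖k‖ / |t| + ‖R (-t) w‖ := by
    rw [h.2, map_sub]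
    refine (norm_sub_le _ _).trans (add_le_add_left ?_ _)
    simpa using P.res.norm_le (neg_ne_zero.mpr ht0) k
  have h3 : c * (‖k‖ / |t|) ≤ ‖k‖ / 2 := by
    rw [← mul_div_assoc, div_le_iff₀ (abs_pos.mpr ht0)]
    nlinarith [norm_nonneg k]
  nlinarith

/-- The anticommutator bound makes k Cauchy, so convergence of q = STx alone forces that of TSx = k
− q; closedness of S and T does the rest. -/
theorem tendsto_antiRel [CompleteSpace E] {x u v k q : ℕ → E} {x₀ u₀ v₀ : E}
    (h : ∀ n, AntiRel S T (x n) (u n) (v n) (k n)) (hq : ∀ n, (v n, q n) ∈ S.graph)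
    (hx : Tendsto x atTop (𝓝 x₀)) (hu : Tendsto u atTop (𝓝 u₀)) (hv : Tendsto v atTop (𝓝 v₀))
    (hqc : CauchySeq q) : ∃ κ, Tendsto k atTop (𝓝 κ) ∧ AntiRel S T x₀ u₀ v₀ κ := by
  have hk : CauchySeq k := cauchySeq_of_norm_sub_le c P.pos.le hx.cauchySeq hu.cauchySeq
    hv.cauchySeq fun n m => P.bound ((h n).sub (h m))
  obtain ⟨κ, hκ⟩ := cauchySeq_tendsto_of_complete hk
  obtain ⟨r, hr⟩ := cauchySeq_tendsto_of_complete hqc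
  refine ⟨κ, hκ, ?_, ?_, κ - r, r, ?_, ?_, by abel⟩
  · exact P.closedS.mem_of_tendsto (hx.prodMk_nhds hu) (.of_forall fun n => (h n).1)
  · exact P.closedT.mem_of_tendsto (hx.prodMk_nhds hv) (.of_forall fun n => (h n).2.1)
  · exact P.closedT.mem_of_tendsto (hu.prodMk_nhds (hκ.sub hr))
      (.of_forall fun n => (h n).snd_mem (hq n))
  · exact P.closedS.mem_of_tendsto (hv.prodMk_nhds hr) (.of_forall hq)

/-- Applying T to (S + it)y = x gives TSy = w − itv, hence (S − it)v = k − w. Anticommutation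
reverses the sign of t. -/
theorem resRel_of_antiRel {t : ℝ} (ht : t ≠ 0) {x w v k : E} (hw : (x, w) ∈ T.graph)
    (h : AntiRel S T (R t x) (x - (t * I) • R t x) v k) : ResRel S T R t x w v k := by
  refine ⟨h, ?_⟩
  obtain ⟨-, h2, p, q, h3, h4, rfl⟩ := h
  have hp : p = w - (t * I) • v :=
    T.mem_graph_snd_inj h3 (T.graph.sub_mem hw (T.graph.smul_mem (t * I) h2)) rfl
  have := P.res.left_inv (neg_ne_zero.mpr ht) h4
  rw [← this]
  congr 1
  rw [hp, ofReal_neg]; module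

/-- For large `|t|` the resolvent of `S` maps the domain of `T` into `F(S,T)`. -/
theorem exists_resRel [CompleteSpace E] : ∃ t₀ : ℝ, 0 < t₀ ∧ 2 * c ≤ t₀ ∧ ∀ t : ℝ, t₀ ≤ |t| →
    ∀ x w, (x, w) ∈ T.graph → ∃ v k, ResRel S T R t x w v k := by
  obtain ⟨V, hV, l₀, hl₀, hVR⟩ := P.core
  have hc := P.pos
  refine ⟨max (max 1 l₀) (2 * c), by positivity, le_max_right _ _, fun t ht x w hxw => ?_⟩
  simp only [max_le_iff] at ht
  obtain ⟨⟨ht1, htl⟩, htc⟩ := ht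
  have ht0 : t ≠ 0 := abs_pos.mp (by linarith)
  have ht0' := neg_ne_zero.mpr ht0
  obtain ⟨f, hf, hlim⟩ := hV x w hxw
  choose v k hvk using fun n => hVR t htl (f n).1 (hf n).1
  have hres : ∀ n, ResRel S T R t (f n).1 (f n).2 (v n) (k n) := fun n =>
    P.resRel_of_antiRel ht0 (hf n).2 (hvk n)
  have hlx : Tendsto (fun n => (f n).1) atTop (𝓝 x) := (continuous_fst.tendsto _).comp hlim
  have hlw : Tendsto (fun n => (f n).2) atTop (𝓝 w) := (continuous_snd.tendsto _).comp hlim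
  have hk : CauchySeq k := by
    refine cauchySeq_of_norm_sub_le (2 * c) (by positivity) hlx.cauchySeq hlx.cauchySeq
      hlw.cauchySeq fun n m => ?_
    refine (P.norm_le_of_resRel htc ((hres n).sub (hres m))).trans ?_
    have hdiv : ∀ a : E, ‖a‖ / |t| ≤ ‖a‖ := fun a => div_le_self (norm_nonneg _) ht1
    gcongr
    · exact (P.res.norm_le ht0 _).trans (hdiv _)
    · exact P.res.norm_sub_le ht0 _
    · exact (P.res.norm_le ht0' _).trans (by rw [abs_neg]; exact hdiv _)
  obtain ⟨κ, hκ⟩ := cauchySeq_tendsto_of_complete hk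
  have hlv : Tendsto v atTop (𝓝 (R (-t) (κ - w))) := by
    refine Tendsto.congr (fun n => (hres n).2.symm) ?_
    exact ((R (-t)).continuous.tendsto _).comp (hκ.sub hlw)
  have hly : Tendsto (fun n => R t (f n).1) atTop (𝓝 (R t x)) :=
    ((R t).continuous.tendsto _).comp hlx
  obtain ⟨κ', hκ', hA⟩ := P.tendsto_antiRel (fun n => (hres n).1)
    (q := fun n => k n - (f n).2 - ((-t : ℝ) * I) • v n)
    (fun n => by
      have := P.res.mem ht0' (k n - (f n).2)
      rwa [← (hres n).2] at this)
    hly (hlx.sub (hly.const_smul _)) hlv ((hκ.sub hlw).sub (hlv.const_smul _)).cauchySeq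
  obtain rfl := tendsto_nhds_unique hκ hκ'
  exact ⟨_, _, hA, rfl⟩

/-- Convergence of the resolvent approximations on `D(S) ∩ D(T)`. -/
theorem tendsto_of_resRel {t : ℕ → ℝ} (htc : ∀ n, 2 * c ≤ |t n|)
    (ht : Tendsto (fun n => |t n|) atTop atTop) {x u w : E} (hu : (x, u) ∈ S.graph) {v k : ℕ → E}
    (h : ∀ n, ResRel S T R (t n) x w (v n) (k n)) :
    Tendsto (fun n => (t n * I) • v n) atTop (𝓝 w) ∧ CauchySeq (fun n => (t n * I) • k n) := by
  have hc := P.pos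
  have ht0 : ∀ n, t n ≠ 0 := fun n => abs_pos.mp (by linarith [htc n])
  have ht0' : ∀ n, -t n ≠ 0 := fun n => neg_ne_zero.mpr (ht0 n)
  -- As x ∈ D(S), all three terms bounding k are O(1/|t|).
  have hk : Tendsto k atTop (𝓝 0) := by
    refine squeeze_zero_norm (fun n => ?_)
      ((tendsto_const_nhds (x := 2 * c * (‖x‖ + ‖u‖ + ‖w‖))).div_atTop ht)
    refine (P.norm_le_of_resRel (htc n) (h n)).trans ?_
    rw [P.res.apply_sub (ht0 n) hu]
    have h3 := P.res.norm_le (ht0' n) w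
    rw [abs_neg] at h3
    calc _ ≤ 2 * c * (‖x‖ / |t n| + ‖u‖ / |t n| + ‖w‖ / |t n|) := by
          gcongr
          · exact P.res.norm_le (ht0 n) x
          · exact P.res.norm_le (ht0 n) u
      _ = _ := by ring
  have hv : Tendsto (fun n => (t n * I) • v n) atTop (𝓝 w) := by
    have := (P.res.tendsto_smul P.denseS ht0' (by simpa using ht)
      (hk.sub (tendsto_const_nhds (x := w)))).neg
    simp only [zero_sub, neg_neg] at this
    refine this.congr fun n => ?_
    rw [(h n).2, ofReal_neg]; module
  refine ⟨hv, ?_⟩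
  have hx := P.res.tendsto_smul P.denseS ht0 ht (tendsto_const_nhds (x := x))
  have hu' := P.res.tendsto_smul P.denseS ht0 ht (tendsto_const_nhds (x := u))
  refine cauchySeq_of_norm_sub_le c hc.le hx.cauchySeq hu'.cauchySeq hv.cauchySeq fun n m => ?_
  refine P.bound (((h n).1.smul (t n * I)).sub ((h m).1.smul (t m * I)) |> fun h => ?_)
  simpa only [P.res.apply_sub (ht0 _) hu] using h

theorem exists_tendsto_antiRel [CompleteSpace E] {x u w : E} (hu : (x, u) ∈ S.graph)
    (hw : (x, w) ∈ T.graph) : ∃ x' u' v' k' : ℕ → E,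
      (∀ n, AntiRel S T (x' n) (u' n) (v' n) (k' n)) ∧ Tendsto x' atTop (𝓝 x) ∧
      Tendsto u' atTop (𝓝 u) ∧ Tendsto v' atTop (𝓝 w) := by
  obtain ⟨t₀, ht₀, htc, hres⟩ := P.exists_resRel
  have hpos : ∀ n : ℕ, 0 < t₀ + n := fun n => by positivity
  have habs : ∀ n : ℕ, |t₀ + n| = t₀ + n := fun n => abs_of_pos (hpos n)
  have ht : Tendsto (fun n : ℕ => |t₀ + n|) atTop atTop := by
    simp only [habs]
    exact tendsto_atTop_add_const_left _ _ tendsto_natCast_atTop_atTop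
  choose v k hvk using fun n : ℕ =>
    hres (t₀ + n) (by rw [habs]; linarith [(Nat.cast_nonneg n : (0 : ℝ) ≤ n)]) x w hw
  have h1 := P.tendsto_of_resRel (t := fun n : ℕ => t₀ + n)
    (fun n => by rw [habs]; linarith [(Nat.cast_nonneg n : (0 : ℝ) ≤ n)]) ht hu hvk
  refine ⟨_, _, _, _, fun n => (hvk n).1.smul ((t₀ + n : ℝ) * I),
    P.res.tendsto_smul P.denseS (fun n => (hpos n).ne') ht tendsto_const_nhds, ?_, h1.1⟩
  simp only [fun n : ℕ => P.res.apply_sub (hpos n).ne' hu]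
  exact P.res.tendsto_smul P.denseS (fun n => (hpos n).ne') ht tendsto_const_nhds

/-- On F(S,T) symmetry turns the mixed term into ⟨x, (ST + TS)x⟩. The general case is a limit along
it(S + it)⁻¹x, where x, Sx and Tx all converge. -/
theorem norm_mixed_le [CompleteSpace E] {x u w : E} (hu : (x, u) ∈ S.graph)
    (hw : (x, w) ∈ T.graph) :
    ‖inner B u w + inner B w u‖ ≤ c * ‖x‖ * (‖x‖ + ‖u‖ + ‖w‖) := by
  have key : ∀ {x u v k : E}, AntiRel S T x u v k →
      ‖inner B u v + inner B v u‖ ≤ c * ‖x‖ * (‖x‖ + ‖u‖ + ‖v‖) := by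
    intro x u v k h
    have hb := P.bound h
    obtain ⟨h1, h2, p, q, h3, h4, rfl⟩ := h
    rw [← P.symS _ _ _ _ h1 h4, ← P.symT _ _ _ _ h2 h3, ← CStarModule.inner_add_right, add_comm q]
    refine (CStarModule.norm_inner_le E).trans ?_
    nlinarith [norm_nonneg x]
  obtain ⟨x', u', v', k', h, hx, hu', hv⟩ := P.exists_tendsto_antiRel hu hw
  have hcont : Continuous fun p : E × E => inner B p.1 p.2 := CStarModule.continuous_inner
  refine le_of_tendsto_of_tendsto'
    (((hcont.tendsto (u, w)).comp (hu'.prodMk_nhds hv)).add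
      ((hcont.tendsto (w, u)).comp (hv.prodMk_nhds hu'))).norm
    ((hx.norm.const_mul c).mul ((hx.norm.add hu'.norm).add hv.norm)) fun n => key (h n)

theorem norm_le_add [CompleteSpace E] {x u w : E} (hu : (x, u) ∈ S.graph)
    (hw : (x, w) ∈ T.graph) :
    ‖u‖ ≤ ‖u + w‖ + (2 * c + 1) * ‖x‖ ∧ ‖w‖ ≤ ‖u + w‖ + (2 * c + 1) * ‖x‖ := by
  have h := P.norm_mixed_le hu hw
  have h1 := norm_sq_le_of_mixed B h
  have h' := h
  rw [add_comm (inner B u w)] at h'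
  have h2 := norm_sq_le_of_mixed B h'
  rw [add_comm w u] at h2
  exact le_of_sq_le_add_mul (norm_nonneg _) (norm_nonneg _) P.pos.le h1 h2

end AnticommPair

end Pairs

/-! ### The sum S + T: closed, densely defined, surjective off the real axis. -/

section Sum

theorem mem_graph_add_iff {E : Type*} [AddCommGroup E] [Module ℂ E] {S T : E →ₗ.[ℂ] E} {x d : E} :
    (x, d) ∈ (S + T).graph ↔ ∃ u w, (x, u) ∈ S.graph ∧ (x, w) ∈ T.graph ∧ u + w = d := by
  constructor
  · intro h
    obtain ⟨y, rfl, rfl⟩ := (LinearPMap.mem_graph_iff _).mp h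
    exact ⟨_, _, S.mem_graph ⟨y, y.2.1⟩, T.mem_graph ⟨y, y.2.2⟩, rfl⟩
  · rintro ⟨u, w, hu, hw, rfl⟩
    obtain ⟨⟨a, ha⟩, h, rfl⟩ := (LinearPMap.mem_graph_iff _).mp hu
    obtain rfl : a = x := h
    obtain ⟨⟨b, hb⟩, h, rfl⟩ := (LinearPMap.mem_graph_iff _).mp hw
    obtain rfl : b = a := h
    exact (S + T).mem_graph ⟨b, ha, hb⟩

variable {B : Type*} {E : Type*} [NonUnitalCStarAlgebra B] [PartialOrder B] [StarOrderedRing B]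
  [NormedAddCommGroup E] [NormedSpace ℂ E] [SMul B E] [CStarModule B E]

theorem SymRel.add {S T : E →ₗ.[ℂ] E} (hS : SymRel B S.graph) (hT : SymRel B T.graph) :
    SymRel B (S + T).graph := by
  intro x d y e hx hy
  obtain ⟨u, w, hu, hw, rfl⟩ := mem_graph_add_iff.mp hx
  obtain ⟨u', w', hu', hw', rfl⟩ := mem_graph_add_iff.mp hy
  rw [CStarModule.inner_add_right, CStarModule.inner_add_left, hS _ _ _ _ hu hu',
    hT _ _ _ _ hw hw']

/-- Bounded symmetric perturbations preserve the solvability of `G + z` for nonreal `z`. -/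
theorem SymRel.exists_add_bounded [CompleteSpace E] {G : Submodule ℂ (E × E)} (hG : SymRel B G)
    (hs : ∀ z : ℂ, z.im ≠ 0 → Solvable G z) (M : E →L[ℂ] E)
    (hM : ∀ x y, inner B (M x) y = inner B x (M y)) {z : ℂ} (hz : z.im ≠ 0) (y : E) :
    ∃ x, (x, y - z • x - M x) ∈ G ∧ |z.im| * ‖x‖ ≤ ‖y‖ := by
  let G' : Submodule ℂ (E × E) := G.comap (LinearMap.prod (LinearMap.fst ℂ E E)
    (LinearMap.snd ℂ E E - (M : E →ₗ[ℂ] E) ∘ₗ LinearMap.fst ℂ E E))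
  have mem : ∀ x u, (x, u) ∈ G' ↔ (x, u - M x) ∈ G := fun x u => Iff.rfl
  have hG' : SymRel B G' := by
    intro x u x' u' h h'
    have := hG _ _ _ _ h h'
    simpa [CStarModule.inner_sub_right, CStarModule.inner_sub_left, hM] using this
  have hz0 : 0 < |z.im| := abs_pos.mpr hz
  -- Scaling z until its imaginary part has modulus ‖M‖ + 1 puts it in reach of the Neumann series;
  -- the half-plane argument for the symmetric relation G + M then returns to z.
  have hw : (((‖M‖ + 1) / |z.im| : ℝ) * z).im = (‖M‖ + 1) / |z.im| * z.im := by simp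
  have h1 : Solvable G' (((‖M‖ + 1) / |z.im| : ℝ) * z) := by
    intro y
    obtain ⟨x, hx⟩ := hG.solvable_perturb (hs (((‖M‖ + 1) / |z.im| : ℝ) * z)
      (by rw [hw]; positivity)) M
      (by
        rw [hw, abs_mul, abs_of_pos (by positivity : 0 < (‖M‖ + 1) / |z.im|),
          div_mul_cancel₀ _ hz0.ne']
        linarith) y
    exact ⟨x, hx⟩
  obtain ⟨x, hx⟩ := hG'.solvable_of_im_mul_pos h1 (w := z) (by
    rw [hw, mul_assoc]; exact mul_pos (by positivity) (mul_self_pos.mpr hz)) y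
  exact ⟨x, hx, by simpa using hG'.norm_im_le z hx⟩

namespace AnticommPair

variable {S T : E →ₗ.[ℂ] E} {R : ℝ → E →L[ℂ] E} {c : ℝ} (P : AnticommPair B S T R c)

include P

/-- The sign reversals at t and −t cancel in the difference of resolvents, so T passes through
`smoothing` up to an anticommutator term. -/
theorem antiRel_smoothing {t : ℝ} (ht : t ≠ 0) {x w v₁ k₁ v₂ k₂ : E}
    (h₁ : ResRel S T R t x w v₁ k₁) (h₂ : ResRel S T R (-t) x w v₂ k₂) :
    AntiRel S T (smoothing R t x) (boundedApprox R t x)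
      (smoothing R t w + (t * I / 2) • (R (-t) k₁ - R t k₂)) ((t * I / 2) • (k₁ - k₂)) := by
  have h := (h₁.1.sub h₂.1).smul (t * I / 2)
  have hu := S.mem_graph_snd_inj h.1 (P.res.smoothing_mem ht x) rfl
  have hv : (t * I / 2 : ℂ) • (v₁ - v₂) =
      smoothing R t w + (t * I / 2) • (R (-t) k₁ - R t k₂) := by
    rw [h₁.2, h₂.2, neg_neg]
    simp only [smoothing, map_sub, smul_apply, sub_apply]
    module
  rw [hu, hv] at h
  exact h

/-- The point is uniformity in s: `boundedApprox R s f` may be large, but it is S applied to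
`smoothing R s f`, and S(S − it)⁻¹ is a contraction. -/
theorem norm_anticomm_le {s t τ : ℝ} (hs : s ≠ 0) (ht : 2 * c ≤ |t|) (ht1 : 1 ≤ |t|)
    {f y w v k : E} (hw : w = y - (τ * I) • f - boundedApprox R s f) (hf : |τ| * ‖f‖ ≤ ‖y‖)
    (h : ResRel S T R t f w v k) : ‖k‖ ≤ 2 * c * (3 * ‖f‖ + 2 * ‖y‖ / |t|) := by
  have hc := P.pos
  have ht0 : t ≠ 0 := abs_pos.mp (by linarith)
  have ht0' := neg_ne_zero.mpr ht0
  refine (P.norm_le_of_resRel ht h).trans ?_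
  have h1 : ‖R t f‖ ≤ ‖f‖ := (P.res.norm_le ht0 f).trans (div_le_self (norm_nonneg _) ht1)
  have h2 := P.res.norm_sub_le ht0 f
  have h3 : ‖R (-t) (y - (τ * I) • f)‖ ≤ 2 * ‖y‖ / |t| := by
    refine (P.res.norm_le ht0' _).trans ?_
    rw [abs_neg]
    gcongr
    refine (norm_sub_le _ _).trans ?_
    have : ‖((τ : ℂ) * I) • f‖ = |τ| * ‖f‖ := by simp [norm_smul]
    linarith
  have h4 : ‖R (-t) (boundedApprox R s f)‖ ≤ ‖f‖ := by
    rw [← P.res.apply_sub ht0' (P.res.smoothing_mem hs f)]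
    exact (P.res.norm_sub_le ht0' _).trans (P.res.norm_smoothing_le hs f)
  have h5 : ‖R (-t) w‖ ≤ 2 * ‖y‖ / |t| + ‖f‖ := by
    rw [hw, map_sub]
    exact (norm_sub_le _ _).trans (add_le_add h3 h4)
  exact mul_le_mul_of_nonneg_left (by linarith) (by positivity)

theorem dense_range_add [CompleteSpace E] {τ : ℝ} (hτ : 48 * c ≤ |τ|) :
    Dense {y : E | ∃ x d, (x, d) ∈ (S + T).graph ∧ d + ((τ : ℂ) * I) • x = y} := by
  have hc := P.pos
  have hτ0 : 0 < |τ| := by linarith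
  let W : Submodule ℂ E := (S + T).graph.map
    (LinearMap.snd ℂ E E + ((τ : ℂ) * I) • LinearMap.fst ℂ E E)
  have hW : (W : Set E) = {y : E | ∃ x d, (x, d) ∈ (S + T).graph ∧ d + ((τ : ℂ) * I) • x = y} := by
    ext y
    constructor
    · rintro ⟨⟨x, d⟩, h, rfl⟩
      exact ⟨x, d, h, rfl⟩
    · rintro ⟨x, d, h, rfl⟩
      exact ⟨(x, d), h, rfl⟩
  rw [← hW]
  refine dense_of_approx W (c := 3 / 4) (by norm_num) fun y => ?_
  rcases eq_or_ne y 0 with rfl | hy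
  · exact ⟨0, W.zero_mem, by simp⟩
  have hy0 := norm_pos_iff.mpr hy
  obtain ⟨t₀, ht₀, -, hres⟩ := P.exists_resRel
  have habs : ∀ n : ℕ, |(n + 1 : ℝ)| = n + 1 := fun n => abs_of_pos (by positivity)
  have hlim := P.res.tendsto_smoothing P.denseS (t := fun n : ℕ => n + 1)
    (fun n => by positivity) (by
      simp only [habs]
      exact tendsto_atTop_add_const_right _ _ tendsto_natCast_atTop_atTop) y
  obtain ⟨N, hN⟩ := Metric.tendsto_atTop.mp hlim (‖y‖ / 4) (by positivity)
  obtain ⟨M, hM⟩ := exists_nat_ge (max t₀ (32 * c))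
  obtain ⟨n, hn, hn1, hn2, hn3⟩ : ∃ n : ℝ, 1 ≤ n ∧ ‖y - smoothing R n y‖ ≤ ‖y‖ / 4 ∧ t₀ ≤ n ∧
      32 * c ≤ n := by
    refine ⟨((max N M : ℕ) : ℝ) + 1, by simp, ?_, ?_, ?_⟩
    · have := hN (max N M) (le_max_left _ _)
      rw [dist_comm, dist_eq_norm] at this
      exact this.le
    all_goals
      have h1 : (M : ℝ) ≤ (max N M : ℕ) := by exact_mod_cast le_max_right _ _
      have h2 := (le_max_left _ _).trans hM
      have h3 := (le_max_right _ _).trans hM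
      linarith
  have hn0 : 0 < n := by linarith
  have hna : |n| = n := abs_of_pos hn0
  -- With n fixed, this m makes n²/m · ‖f‖ = |τ|‖f‖/4 ≤ ‖y‖/4.
  set m : ℝ := 4 * n ^ 2 / |τ| with hm
  have hm0 : 0 < m := by positivity
  obtain ⟨f, hfT, hf⟩ := P.symT.exists_add_bounded P.solvableT (boundedApprox R m)
    (P.res.inner_boundedApprox P.symS hm0.ne') (z := τ * I) (by simpa using abs_pos.mp hτ0) y
  replace hf : |τ| * ‖f‖ ≤ ‖y‖ := by simpa using hf
  set w := y - ((τ : ℂ) * I) • f - boundedApprox R m f with hw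
  obtain ⟨v₁, k₁, h₁⟩ := hres n (by rwa [hna]) f w hfT
  obtain ⟨v₂, k₂, h₂⟩ := hres (-n) (by rwa [abs_neg, hna]) f w hfT
  have hA := P.antiRel_smoothing hn0.ne' h₁ h₂
  -- In 6c‖f‖ + 4c‖y‖/n each term is at most ‖y‖/8, by 48c ≤ |τ| and 32c ≤ n.
  have bk : ∀ s v k, |s| = n → ResRel S T R s f w v k → ‖k‖ ≤ ‖y‖ / 4 := by
    intro s v k hs h
    refine (P.norm_anticomm_le hm0.ne' (by linarith) (by linarith) hw hf h).trans ?_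
    rw [hs]
    have h1 : c * ‖f‖ ≤ ‖y‖ / 48 := by nlinarith [norm_nonneg f]
    have h2 : c * (‖y‖ / n) ≤ ‖y‖ / 32 := by
      rw [← mul_div_assoc, div_le_iff₀ hn0]; nlinarith
    rw [mul_div_assoc]
    linarith
  have b₁ := bk n v₁ k₁ hna h₁
  have b₂ := bk (-n) v₂ k₂ (by rw [abs_neg, hna]) h₂
  refine ⟨_, ⟨(_, _), mem_graph_add_iff.mpr ⟨_, _, hA.1, hA.2.1, rfl⟩, rfl⟩, ?_⟩
  have e1 : ‖((n : ℂ) * I / 2) • (R (-n) k₁ - R n k₂)‖ ≤ ‖y‖ / 4 := by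
    have g1 := P.res.norm_smul_le (neg_ne_zero.mpr hn0.ne') k₁
    have g2 := P.res.norm_smul_le hn0.ne' k₂
    have : ((n : ℂ) * I / 2) • (R (-n) k₁ - R n k₂) =
        -(1 / 2 : ℂ) • ((((-n : ℝ) : ℂ) * I) • R (-n) k₁ + ((n : ℂ) * I) • R n k₂) := by
      rw [ofReal_neg]; module
    rw [this, norm_smul]
    have := norm_add_le ((((-n : ℝ) : ℂ) * I) • R (-n) k₁) (((n : ℂ) * I) • R n k₂)
    norm_num at *
    linarith
  have e2 : ‖boundedApprox R n f - smoothing R n (boundedApprox R m f)‖ ≤ ‖y‖ / 4 := by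
    refine (P.res.norm_boundedApprox_sub_le hn0.ne' hm0.ne' f).trans ?_
    rw [abs_of_pos hm0, hm]
    -- The choice of m is used here.
    calc _ = |τ| * ‖f‖ / 4 := by field_simp
      _ ≤ _ := by gcongr
  have e3 : y - (LinearMap.snd ℂ E E + ((τ : ℂ) * I) • LinearMap.fst ℂ E E)
      (smoothing R n f, boundedApprox R n f + (smoothing R n w +
        ((n : ℂ) * I / 2) • (R (-n) k₁ - R n k₂))) =
      (y - smoothing R n y) - (boundedApprox R n f - smoothing R n (boundedApprox R m f)) -
        ((n : ℂ) * I / 2) • (R (-n) k₁ - R n k₂) := by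
    rw [hw]
    simp only [LinearMap.add_apply, LinearMap.smul_apply, LinearMap.snd_apply,
      LinearMap.fst_apply, map_sub, map_smul]
    abel
  rw [e3]
  refine (norm_sub_le _ _).trans ?_
  have := norm_sub_le (y - smoothing R n y)
    (boundedApprox R n f - smoothing R n (boundedApprox R m f))
  linarith

/-- By `norm_le_add`, convergence of x and (S + T)x forces that of Sx and Tx separately. -/
theorem isClosed_graph_add [CompleteSpace E] : IsClosed ((S + T).graph : Set (E × E)) := by
  have hc := P.pos
  refine IsSeqClosed.isClosed fun p q hp hpq => ?_
  choose u w hu hw hd using fun n => mem_graph_add_iff.mp (hp n)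
  have hx : Tendsto (fun n => (p n).1) atTop (𝓝 q.1) := (continuous_fst.tendsto _).comp hpq
  have hd' : Tendsto (fun n => (p n).2) atTop (𝓝 q.2) := (continuous_snd.tendsto _).comp hpq
  have huc : CauchySeq u := by
    refine cauchySeq_of_norm_sub_le (2 * c + 1) (by positivity) hd'.cauchySeq hx.cauchySeq
      hx.cauchySeq fun n m => ?_
    have := (P.norm_le_add (u := u n - u m) (w := w n - w m) (S.graph.sub_mem (hu n) (hu m))
      (T.graph.sub_mem (hw n) (hw m))).1
    simp only at this
    rw [show u n - u m + (w n - w m) = (p n).2 - (p m).2 by rw [← hd, ← hd]; abel] at this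
    have h1 := mul_nonneg hc.le (norm_nonneg ((p n).2 - (p m).2))
    have h2 := mul_nonneg hc.le (norm_nonneg ((p n).1 - (p m).1))
    have h3 := norm_nonneg ((p n).1 - (p m).1)
    linarith
  obtain ⟨a, ha⟩ := cauchySeq_tendsto_of_complete huc
  refine mem_graph_add_iff.mpr ⟨a, q.2 - a, ?_, ?_, by abel⟩
  · exact P.closedS.mem_of_tendsto (hx.prodMk_nhds ha) (.of_forall hu)
  · refine P.closedT.mem_of_tendsto (hx.prodMk_nhds (hd'.sub ha)) (.of_forall fun n => ?_)
    rw [← hd, add_sub_cancel_left]; exact hw n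

theorem solvable_add [CompleteSpace E] {z : ℂ} (hz : z.im ≠ 0) : Solvable (S + T).graph z := by
  have hc := P.pos
  have hsym := P.symS.add P.symT
  have key : ∀ τ : ℝ, 48 * c ≤ |τ| → Solvable (S + T).graph (τ * I) := fun τ hτ =>
    hsym.solvable_of_dense P.isClosed_graph_add
      (by simpa using abs_pos.mp (lt_of_lt_of_le (by positivity) hτ)) (P.dense_range_add hτ)
  have habs : |48 * c| = 48 * c := abs_of_pos (by positivity)
  refine hsym.solvable (z₀ := (48 * c : ℝ) * I) (by simpa using hc.ne') (key _ habs.ge) ?_ hz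
  have := key (-(48 * c)) (by rw [abs_neg]; exact habs.ge)
  simpa using this

theorem dense_domain_add [CompleteSpace E] : Dense ((S + T).domain : Set E) := by
  rw [← dense_closure]
  refine P.denseT.mono fun x hx => ?_
  obtain ⟨w, hw⟩ := LinearPMap.mem_domain_iff.mp hx
  obtain ⟨t₀, ht₀, -, hres⟩ := P.exists_resRel
  have hpos : ∀ n : ℕ, 0 < t₀ + n := fun n => by positivity
  have habs : ∀ n : ℕ, |t₀ + n| = t₀ + n := fun n => abs_of_pos (hpos n)
  refine mem_closure_of_tendsto (P.res.tendsto_smul P.denseS (t := fun n : ℕ => t₀ + n)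
    (fun n => (hpos n).ne') ?_ (tendsto_const_nhds (x := x))) (.of_forall fun n => ?_)
  · simp only [habs]
    exact tendsto_atTop_add_const_left _ _ tendsto_natCast_atTop_atTop
  · obtain ⟨v, k, h⟩ := hres (t₀ + n) (by rw [habs]; linarith [(Nat.cast_nonneg n : (0 : ℝ) ≤ n)])
      x w hw
    exact (S + T).domain.smul_mem _ ⟨LinearPMap.mem_domain_of_mem_graph h.1.1,
      LinearPMap.mem_domain_of_mem_graph h.1.2.1⟩

end AnticommPair

end Sum

/-! ### Regularity of x when (S + T)x lies in the domain of S. -/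

section Squares

variable {B : Type*} {E : Type*} [NonUnitalCStarAlgebra B] [PartialOrder B] [StarOrderedRing B]
  [NormedAddCommGroup E] [NormedSpace ℂ E] [SMul B E] [CStarModule B E]

namespace AnticommPair

variable {S T : E →ₗ.[ℂ] E} {R : ℝ → E →L[ℂ] E} {c : ℝ} (P : AnticommPair B S T R c)

include P

/-- A priori estimate for `S T x` in terms of `S (S + T) x`. -/
theorem norm_le_of_antiRel [CompleteSpace E] {x u v k a q : E} (h : AntiRel S T x u v k)
    (ha : (u, a) ∈ S.graph) (hq : (v, q) ∈ S.graph) :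
    ‖q‖ ≤ ‖a + q‖ + (2 * (c * (3 + c)) + 1) * (‖x‖ + ‖u‖ + ‖v‖) := by
  have hc := P.pos
  have hk := P.bound h
  have hp := h.snd_mem hq
  -- The mixed-term estimate is used at u = Sx, where Su = a and Tu = k − q; replacing −q by k − q
  -- costs only the first-order term k.
  have hm := P.norm_mixed_le ha hp
  have hp' : ‖k - q‖ ≤ c * (‖x‖ + ‖u‖ + ‖v‖) + ‖q‖ := (norm_sub_le _ _).trans (by linarith)
  set A := ‖x‖ + ‖u‖ + ‖v‖ with hA
  have hA0 : 0 ≤ A := by positivity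
  have huA : ‖u‖ ≤ A := by
    have h1 := norm_nonneg x
    have h2 := norm_nonneg v
    linarith
  have e : inner B a q + inner B q a =
      (inner B a k + inner B k a) - (inner B a (k - q) + inner B (k - q) a) := by
    simp only [CStarModule.inner_sub_left, CStarModule.inner_sub_right]; abel
  have h1 : ‖inner B a q + inner B q a‖ ≤ c * (3 + c) * A * (A + ‖a‖ + ‖q‖) := by
    rw [e]
    have g1 : ‖inner B a k‖ ≤ ‖a‖ * (c * A) :=
      (CStarModule.norm_inner_le E).trans (by gcongr)
    have g2 : ‖inner B k a‖ ≤ (c * A) * ‖a‖ :=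
      (CStarModule.norm_inner_le E).trans (by gcongr)
    have g3 : ‖inner B a (k - q) + inner B (k - q) a‖ ≤ c * A * (A + ‖a‖ + (c * A + ‖q‖)) :=
      hm.trans (by gcongr)
    refine (norm_sub_le _ _).trans ((add_le_add (norm_add_le _ _) le_rfl).trans ?_)
    have n1 : 0 ≤ c * A := by positivity
    have n2 := mul_nonneg n1 hA0
    have n3 := mul_nonneg n1 (norm_nonneg a)
    have n4 := mul_nonneg n1 (norm_nonneg q)
    have n5 := mul_nonneg hc.le n3
    have n6 := mul_nonneg hc.le n4
    nlinarith
  have s1 := norm_sq_le_of_mixed B h1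
  have h2 := h1
  rw [add_comm (inner B a q)] at h2
  have s2 := norm_sq_le_of_mixed B h2
  rw [add_comm q a] at s2
  exact (le_of_sq_le_add_mul (norm_nonneg _) hA0 (by positivity) s1 s2).2

/-- Elements `x` of `D(S) ∩ D(T)` with `(S + T) x ∈ D(S)` belong to `F(S,T)`. -/
theorem exists_antiRel_of_add_mem [CompleteSpace E] {x u w s : E} (hu : (x, u) ∈ S.graph)
    (hw : (x, w) ∈ T.graph) (hs : (u + w, s) ∈ S.graph) : ∃ k, AntiRel S T x u w k := by
  have hc := P.pos
  obtain ⟨t₀, ht₀, htc, hres⟩ := P.exists_resRel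
  set t : ℕ → ℝ := fun n => t₀ + n with ht_def
  have hpos : ∀ n, 0 < t n := fun n => by positivity
  have hge : ∀ n, t₀ ≤ |t n| := fun n => by
    rw [abs_of_pos (hpos n)]; linarith [(Nat.cast_nonneg n : (0 : ℝ) ≤ n)]
  have hge' : ∀ n, t₀ ≤ |-t n| := fun n => by rw [abs_neg]; exact hge n
  have ht0 : ∀ n, t n ≠ 0 := fun n => (hpos n).ne'
  have ht0' : ∀ n, -t n ≠ 0 := fun n => neg_ne_zero.mpr (ht0 n)
  have ht : Tendsto (fun n => |t n|) atTop atTop := by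
    simp only [abs_of_pos (hpos _)]
    exact tendsto_atTop_add_const_left _ _ tendsto_natCast_atTop_atTop
  have ht' : Tendsto (fun n => |-t n|) atTop atTop := by simpa only [abs_neg] using ht
  choose v₁ k₁ h₁ using fun n => hres (t n) (hge n) x w hw
  choose v₂ k₂ h₂ using fun n => hres (-t n) (hge' n) x w hw
  obtain ⟨κ₁, hκ₁⟩ := cauchySeq_tendsto_of_complete
    (P.tendsto_of_resRel (fun n => htc.trans (hge n)) ht hu h₁).2
  obtain ⟨κ₂, hκ₂⟩ := cauchySeq_tendsto_of_complete
    (P.tendsto_of_resRel (fun n => htc.trans (hge' n)) ht' hu h₂).2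
  set g₁ : ℕ → E := fun n => (t n * I) • k₁ n
  set g₂ : ℕ → E := fun n => ((-t n : ℝ) * I) • k₂ n
  have hA := fun n => P.antiRel_smoothing (ht0 n) (h₁ n) (h₂ n)
  set e : ℕ → E := fun n => (1 / 2 : ℂ) • (R (-t n) (g₁ n) + R (t n) (g₂ n)) with he
  have he' : ∀ n, (t n * I / 2 : ℂ) • (R (-t n) (k₁ n) - R (t n) (k₂ n)) = e n := fun n => by
    simp only [he, g₁, g₂, map_smul, ofReal_neg]
    module
  set ε : ℕ → E := fun n => (1 / 2 : ℂ) • ((g₁ n - ((-t n : ℝ) * I) • R (-t n) (g₁ n)) +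
    (g₂ n - (t n * I) • R (t n) (g₂ n))) with hε
  have heε : ∀ n, (e n, ε n) ∈ S.graph := fun n =>
    S.graph.smul_mem _ (S.graph.add_mem (P.res.mem (ht0' n) _) (P.res.mem (ht0 n) _))
  have hε0 : Tendsto ε atTop (𝓝 0) := by
    have := ((P.res.tendsto_sub P.denseS ht0' ht' hκ₁).add
      (P.res.tendsto_sub P.denseS ht0 ht hκ₂)).const_smul (1 / 2 : ℂ)
    rwa [add_zero, smul_zero] at this
  have he0 : Tendsto e atTop (𝓝 0) := by
    have l1 : Tendsto (fun n => R (-t n) (g₁ n)) atTop (𝓝 0) :=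
      squeeze_zero_norm (fun n => P.res.norm_le (ht0' n) _) (hκ₁.norm.div_atTop ht')
    have l2 : Tendsto (fun n => R (t n) (g₂ n)) atTop (𝓝 0) :=
      squeeze_zero_norm (fun n => P.res.norm_le (ht0 n) _) (hκ₂.norm.div_atTop ht)
    have := (l1.add l2).const_smul (1 / 2 : ℂ)
    rwa [add_zero, smul_zero] at this
  have hUeq : ∀ n, boundedApprox R (t n) x = smoothing R (t n) u := fun n =>
    S.mem_graph_snd_inj (P.res.smoothing_mem (ht0 n) x) (P.res.smoothing_map (ht0 n) hu) rfl
  simp only [he', hUeq] at hA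
  -- Here (S + T)x ∈ D(S) enters: `smoothing` of w = Tx is that of (S + T)x minus that of Sx. The
  -- last term may diverge a priori, but it cancels in a + q.
  have hq : ∀ n, (smoothing R (t n) w + e n,
      smoothing R (t n) s + ε n - boundedApprox R (t n) u) ∈ S.graph := fun n => by
    convert S.graph.sub_mem (S.graph.add_mem (P.res.smoothing_map (ht0 n) hs) (heε n))
      (P.res.smoothing_mem (ht0 n) u) using 1
    refine Prod.ext ?_ rfl
    simp only [map_add, Prod.mk_add_mk, Prod.mk_sub_mk]
    abel
  have lQ := fun a => P.res.tendsto_smoothing P.denseS ht0 ht a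
  have lV : Tendsto (fun n => smoothing R (t n) w + e n) atTop (𝓝 w) := by
    simpa using (lQ w).add he0
  -- Four Cauchy sequences control q; two are paired to fit a criterion with three.
  have lF := ((lQ s).add hε0).prodMk_nhds (lQ x)
  have hqc : CauchySeq fun n => smoothing R (t n) s + ε n - boundedApprox R (t n) u := by
    refine cauchySeq_of_norm_sub_le (2 * (2 * (c * (3 + c)) + 1)) (by positivity) lF.cauchySeq
      (lQ u).cauchySeq lV.cauchySeq fun n m => ?_
    refine (P.norm_le_of_antiRel ((hA n).sub (hA m))
      (S.graph.sub_mem (P.res.smoothing_mem (ht0 n) u) (P.res.smoothing_mem (ht0 m) u))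
      (S.graph.sub_mem (hq n) (hq m))).trans ?_
    have b1 := norm_fst_le ((smoothing R (t n) s + ε n, smoothing R (t n) x) -
      (smoothing R (t m) s + ε m, smoothing R (t m) x))
    have b2 := norm_snd_le ((smoothing R (t n) s + ε n, smoothing R (t n) x) -
      (smoothing R (t m) s + ε m, smoothing R (t m) x))
    rw [Prod.fst_sub] at b1
    rw [Prod.snd_sub] at b2
    simp only at b1 b2 ⊢
    set F := ‖(smoothing R (t n) s + ε n, smoothing R (t n) x) -
      (smoothing R (t m) s + ε m, smoothing R (t m) x)‖
    rw [show boundedApprox R (t n) u - boundedApprox R (t m) u +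
      (smoothing R (t n) s + ε n - boundedApprox R (t n) u -
        (smoothing R (t m) s + ε m - boundedApprox R (t m) u)) =
      smoothing R (t n) s + ε n - (smoothing R (t m) s + ε m) by abel]
    have hc1 : 1 ≤ 2 * (c * (3 + c)) + 1 := by
      have : 0 ≤ c * (3 + c) := by positivity
      linarith
    set C := 2 * (c * (3 + c)) + 1
    have n1 := norm_nonneg (smoothing R (t n) u - smoothing R (t m) u)
    have n2 := norm_nonneg (smoothing R (t n) w + e n - (smoothing R (t m) w + e m))
    have n3 : 0 ≤ F := norm_nonneg _
    set p1 := ‖smoothing R (t n) u - smoothing R (t m) u‖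
    set p2 := ‖smoothing R (t n) w + e n - (smoothing R (t m) w + e m)‖
    nlinarith
  obtain ⟨κ, -, hκ⟩ := P.tendsto_antiRel hA hq (lQ x) (lQ u) lV hqc
  exact ⟨κ, hκ⟩

end AnticommPair

end Squares

/-! ### The sum of squares as a perturbation of (S + T)². -/

section Squares

theorem mem_graph_opMul_iff {E : Type*} [AddCommGroup E] [Module ℂ E] {A C : E →ₗ.[ℂ] E}
    {x h : E} : (x, h) ∈ (opMul A C).graph ↔ ∃ u, (x, u) ∈ C.graph ∧ (u, h) ∈ A.graph := by
  constructor
  · intro hx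
    obtain ⟨⟨y, hy⟩, rfl, rfl⟩ := (LinearPMap.mem_graph_iff _).mp hx
    obtain ⟨hC, hA⟩ := (mem_domain_opMul A C y).mp hy
    exact ⟨_, C.mem_graph ⟨y, hC⟩, A.mem_graph ⟨_, hA⟩⟩
  · rintro ⟨u, hu, hh⟩
    obtain ⟨⟨a, ha⟩, rfl, rfl⟩ := (LinearPMap.mem_graph_iff _).mp hu
    obtain ⟨⟨b, hb⟩, h1, rfl⟩ := (LinearPMap.mem_graph_iff _).mp hh
    obtain rfl : b = C ⟨a, ha⟩ := h1
    exact (opMul A C).mem_graph ⟨a, (mem_domain_opMul A C a).mpr ⟨ha, hb⟩⟩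

theorem mem_graph_opSq_iff {E : Type*} [AddCommGroup E] [Module ℂ E] {A : E →ₗ.[ℂ] E}
    {x h : E} : (x, h) ∈ (opSq A).graph ↔ ∃ u, (x, u) ∈ A.graph ∧ (u, h) ∈ A.graph :=
  mem_graph_opMul_iff

theorem AntiRel.mem_anticommDomain {E : Type*} [NormedAddCommGroup E] [NormedSpace ℂ E]
    {S T : E →ₗ.[ℂ] E} {x u v k : E} (h : AntiRel S T x u v k) : x ∈ anticommDomain S T := by
  obtain ⟨h1, h2, p, q, h3, h4, -⟩ := h
  have hS := LinearPMap.mem_domain_of_mem_graph h1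
  have hT := LinearPMap.mem_domain_of_mem_graph h2
  refine ⟨hS, hT, ?_, ?_⟩
  · rw [S.mem_graph_snd_inj (S.mem_graph ⟨x, hS⟩) h1 rfl]
    exact LinearPMap.mem_domain_of_mem_graph h3
  · rw [T.mem_graph_snd_inj (T.mem_graph ⟨x, hT⟩) h2 rfl]
    exact LinearPMap.mem_domain_of_mem_graph h4

theorem exists_antiRel_of_mem_anticommDomain {E : Type*} [NormedAddCommGroup E] [NormedSpace ℂ E]
    {S T : E →ₗ.[ℂ] E} {x u : E} (hu : (x, u) ∈ S.graph) (h : x ∈ anticommDomain S T) :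
    ∃ v k, AntiRel S T x u v k := by
  obtain ⟨hS, hT, h1, h2⟩ := h
  obtain rfl := S.mem_graph_snd_inj hu (S.mem_graph ⟨x, hS⟩) rfl
  exact ⟨_, _, hu, T.mem_graph ⟨x, hT⟩, _, _, T.mem_graph ⟨_, h1⟩, S.mem_graph ⟨_, h2⟩, rfl⟩

variable {B : Type*} {E : Type*} [NonUnitalCStarAlgebra B] [PartialOrder B] [StarOrderedRing B]
  [NormedAddCommGroup E] [NormedSpace ℂ E] [SMul B E] [CStarModule B E]

theorem SymRel.opSq {A : E →ₗ.[ℂ] E} (hA : SymRel B A.graph) : SymRel B (opSq A).graph := by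
  intro x h y l hx hy
  obtain ⟨u, h1, h2⟩ := mem_graph_opSq_iff.mp hx
  obtain ⟨v, h3, h4⟩ := mem_graph_opSq_iff.mp hy
  rw [hA _ _ _ _ h1 h4, hA _ _ _ _ h2 h3]

theorem ImResolvent.dense_domain_opSq {A : E →ₗ.[ℂ] E} {R : ℝ → E →L[ℂ] E}
    (hR : ImResolvent A R) (hd : Dense (A.domain : Set E)) :
    Dense ((HilbertModule.opSq A).domain : Set E) := by
  rw [← dense_closure]
  refine hd.mono fun x hx => ?_
  obtain ⟨u, hu⟩ := LinearPMap.mem_domain_iff.mp hx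
  have hpos : ∀ n : ℕ, (0 : ℝ) < n + 1 := fun n => by positivity
  refine mem_closure_of_tendsto (hR.tendsto_smul hd (t := fun n : ℕ => n + 1)
    (fun n => (hpos n).ne') ?_ (tendsto_const_nhds (x := x))) (.of_forall fun n => ?_)
  · simp only [abs_of_pos (hpos _)]
    exact tendsto_atTop_add_const_right _ _ tendsto_natCast_atTop_atTop
  · exact (HilbertModule.opSq A).domain.smul_mem _ (LinearPMap.mem_domain_of_mem_graph
      (mem_graph_opSq_iff.mpr ⟨_, hR.map (hpos n).ne' hu, hR.mem (hpos n).ne' u⟩))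

theorem SymRel.eq_zero_of_add_smul {G : Submodule ℂ (E × E)} (hG : SymRel B G) {z : ℂ}
    (hz : z.im ≠ 0) {x u : E} (h : (x, u) ∈ G) (h0 : u + z • x = 0) : x = 0 := by
  have := hG.norm_im_le z h
  rw [h0, norm_zero] at this
  have h1 := abs_pos.mpr hz
  exact norm_le_zero_iff.mp (by nlinarith [norm_nonneg x])

/-- A densely defined symmetric operator with `A + z` and `A + z̄` surjective is self-adjoint. -/
theorem SymRel.isSelfAdjointOp {A : E →ₗ.[ℂ] E} (hA : SymRel B A.graph)
    (hd : Dense (A.domain : Set E)) {z : ℂ} (h : Solvable A.graph z)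
    (h' : Solvable A.graph (star z)) : IsSelfAdjointOp B A := by
  refine ⟨hd, fun x ζ => ⟨fun hx y => hA _ _ _ _ hx (A.mem_graph y), fun hx => ?_⟩⟩
  -- With (A + z)w = ζ + zx, the vector x − w is orthogonal to the range of A + z̄, which contains x
  -- − w itself.
  obtain ⟨w, hw⟩ := h (ζ + z • x)
  obtain ⟨y, hy⟩ := h' (x - w)
  have h1 := hA _ _ _ _ hw hy
  obtain ⟨y', rfl, hy'⟩ := (LinearPMap.mem_graph_iff _).mp hy
  have h2 := hx y'
  simp only at hy'
  rw [hy'] at h2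
  have h3 : inner B (x - w) (x - w) = 0 := by
    simp only [CStarModule.inner_sub_left, CStarModule.inner_sub_right,
      CStarModule.inner_add_left, CStarModule.inner_smul_left_complex,
      CStarModule.inner_smul_right_complex] at h1 h2 ⊢
    rw [← sub_eq_zero] at h1 h2
    calc _ = (inner B x x - inner B x w - star z • inner B x (y' : E) - inner B ζ (y' : E)) -
          (inner B w x - inner B w w - star z • inner B w (y' : E) -
            (inner B ζ (y' : E) + star z • inner B x (y' : E) - star z • inner B w (y' : E))) := by
          abel
      _ = 0 := by rw [h1, h2, sub_zero]
  obtain rfl : x = w := sub_eq_zero.mp (CStarModule.inner_self.mp h3)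
  simpa using hw

theorem isRegularOp_of_solvable {A : E →ₗ.[ℂ] E} {z : ℂ} (hz : z.im ≠ 0)
    (h : Solvable A.graph z) (h' : Solvable A.graph (-z)) : IsRegularOp A := by
  refine ⟨z, hz, Function.Surjective.denseRange fun y => ?_,
    Function.Surjective.denseRange fun y => ?_⟩
  · obtain ⟨x, hx⟩ := h y
    obtain ⟨x', rfl, h2⟩ := (LinearPMap.mem_graph_iff _).mp hx
    exact ⟨x', by simp [h2]⟩
  · obtain ⟨x, hx⟩ := h' y
    obtain ⟨x', rfl, h2⟩ := (LinearPMap.mem_graph_iff _).mp hx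
    exact ⟨x', by simp [h2]⟩

/-- The action of B is only a scalar multiplication compatible with the inner product; its
additivity follows from definiteness. -/
theorem op_smul_add (b : B) (x y : E) : b • (x + y) = b • x + b • y := by
  rw [← sub_eq_zero, ← CStarModule.inner_self (A := B)]
  set z := b • (x + y) - (b • x + b • y) with hz
  conv_lhs => rw [hz]
  simp only [CStarModule.inner_sub_right, CStarModule.inner_add_right,
    CStarModule.inner_op_smul_right, mul_add, sub_self]

theorem IsModuleLinear.opSq {A : E →ₗ.[ℂ] E} (hA : IsModuleLinear B A) :
    IsModuleLinear B (HilbertModule.opSq A) := by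
  intro b x hx
  obtain ⟨h1, h2⟩ := (mem_domain_opMul A A x).mp hx
  obtain ⟨h3, h4⟩ := hA b x h1
  obtain ⟨h5, h6⟩ := hA b _ h2
  have h7 : A ⟨b • x, h3⟩ ∈ A.domain := by rw [h4]; exact h5
  refine ⟨(mem_domain_opMul A A _).mpr ⟨h3, h7⟩, ?_⟩
  change A ⟨A ⟨b • x, h3⟩, h7⟩ = b • A ⟨A ⟨x, h1⟩, h2⟩
  rw [← h6]
  congr 1
  exact Subtype.ext h4

theorem IsModuleLinear.add {A C : E →ₗ.[ℂ] E} (hA : IsModuleLinear B A)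
    (hC : IsModuleLinear B C) : IsModuleLinear B (A + C) := by
  intro b x hx
  obtain ⟨h1, h2⟩ := hA b x hx.1
  obtain ⟨h3, h4⟩ := hC b x hx.2
  refine ⟨⟨h1, h3⟩, ?_⟩
  change A ⟨b • x, h1⟩ + C ⟨b • x, h3⟩ = b • (A ⟨x, hx.1⟩ + C ⟨x, hx.2⟩)
  rw [h2, h4, op_smul_add]

namespace AnticommPair

variable {S T : E →ₗ.[ℂ] E} {R : ℝ → E →L[ℂ] E} {c : ℝ} (P : AnticommPair B S T R c)

include P

theorem exists_antiRel_of_sq [CompleteSpace E] {x d e : E} (hd : (x, d) ∈ (S + T).graph)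
    (he : (d, e) ∈ (S + T).graph) : ∃ u v k, AntiRel S T x u v k ∧ u + v = d ∧
      (x, e - k) ∈ (opSq S + opSq T).graph := by
  obtain ⟨u, w, hu, hw, rfl⟩ := mem_graph_add_iff.mp hd
  obtain ⟨s, r, hs, hr, rfl⟩ := mem_graph_add_iff.mp he
  obtain ⟨k, hk⟩ := P.exists_antiRel_of_add_mem hu hw hs
  refine ⟨u, w, k, hk, rfl, ?_⟩
  obtain ⟨-, -, p, q, hp, hq, rfl⟩ := hk
  refine mem_graph_add_iff.mpr ⟨s - q, r - p, mem_graph_opSq_iff.mpr ⟨u, hu, ?_⟩,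
    mem_graph_opSq_iff.mpr ⟨w, hw, ?_⟩, by abel⟩
  · simpa using S.graph.sub_mem hs hq
  · simpa using T.graph.sub_mem hr hp

/-- `S² + T² - α²` maps the domain of `(S + T)²` onto `E` if `α` is far from the real axis. -/
theorem exists_solution_sq [CompleteSpace E] {α : ℂ} (hα : ‖α‖ ≤ 2 * |α.im|) (h1 : 1 ≤ |α.im|)
    (h2 : 2 * (c * (4 * c + 9)) ≤ |α.im|) (y : E) :
    ∃ x ∈ (opSq (S + T)).domain, (x, y - (-α ^ 2) • x) ∈ (opSq S + opSq T).graph := by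
  have hc := P.pos
  have hs0 : 0 < |α.im| := by linarith
  have hα0 : α.im ≠ 0 := abs_pos.mp hs0
  have hα0' : (-α).im ≠ 0 := by simpa using hα0
  have hsym := P.symS.add P.symT
  obtain ⟨R₁, m₁, -, b₁⟩ := hsym.exists_resolvent hα0 (P.solvable_add hα0)
  obtain ⟨R₂, m₂, -, b₂⟩ := hsym.exists_resolvent hα0' (P.solvable_add hα0')
  rw [neg_im, abs_neg] at b₂
  have hD : ∀ h, (R₁ (R₂ h), R₂ h - α • R₁ (R₂ h)) ∈ (S + T).graph := fun h => m₁ _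
  have hD' : ∀ h, (R₂ h - α • R₁ (R₂ h), h + α ^ 2 • R₁ (R₂ h)) ∈ (S + T).graph := fun h => by
    convert (S + T).graph.sub_mem (m₂ h) ((S + T).graph.smul_mem α (hD h)) using 1
    refine Prod.ext rfl ?_
    simp only [Prod.snd_sub, Prod.smul_snd]
    module
  choose u v k hk huv hH using fun h => P.exists_antiRel_of_sq (hD h) (hD' h)
  -- At x = R₁R₂h one has ‖Dx‖ ≤ 3‖R₂h‖, so Sx and Tx are each at most (2c + 4)‖R₂h‖, whence 4c + 9.
  -- The lower bound on |Im α| against ‖R₂h‖ ≤ ‖h‖/|Im α| leaves ½.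
  have hkb : ∀ h, ‖k h‖ ≤ 1 / 2 * ‖h‖ := by
    intro h
    have g1 := P.bound (hk h)
    have g2 := P.norm_le_add (hk h).1 (hk h).2.1
    rw [huv] at g2
    have g3 := b₁ (R₂ h)
    have g4 := b₂ h
    have g5 : ‖R₂ h - α • R₁ (R₂ h)‖ ≤ 3 * ‖R₂ h‖ := by
      refine (norm_sub_le _ _).trans ?_
      rw [norm_smul]
      nlinarith [norm_nonneg (R₁ (R₂ h))]
    have g6 : ‖R₁ (R₂ h)‖ ≤ ‖R₂ h‖ := by nlinarith [norm_nonneg (R₁ (R₂ h))]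
    have g7 : ‖R₁ (R₂ h)‖ + ‖u h‖ + ‖v h‖ ≤ (4 * c + 9) * ‖R₂ h‖ := by nlinarith
    have g8 : ‖k h‖ ≤ c * (4 * c + 9) * ‖R₂ h‖ := by
      refine g1.trans ?_
      rw [mul_assoc]; gcongr
    nlinarith [norm_nonneg (R₂ h)]
  let K : E →ₗ[ℂ] E :=
    { toFun := k
      map_add' := fun a b => by
        have := (hk a).add (hk b)
        rw [← map_add, ← map_add] at this
        exact (hk (a + b)).unique this
      map_smul' := fun a b => by
        have := (hk b).smul a
        rw [← map_smul, ← map_smul] at this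
        exact (hk (a • b)).unique this }
  obtain ⟨h, hh⟩ := exists_add_apply_eq (-(K.mkContinuous (1 / 2) hkb)) (c := 1 / 2)
    (by norm_num) (by norm_num) (fun y => by
      rw [neg_apply, norm_neg]; exact hkb y) y
  replace hh : h - k h = y := by rw [← hh, sub_eq_add_neg]; rfl
  refine ⟨R₁ (R₂ h), LinearPMap.mem_domain_of_mem_graph
    (mem_graph_opSq_iff.mpr ⟨_, hD h, hD' h⟩), ?_⟩
  convert hH h using 2
  rw [← hh]; module

/-- For α = s ± is the numbers −α² = ∓2is² are both conjugate and opposite, so the same two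
surjectivity statements serve self-adjointness and regularity. -/
theorem isSelfAdjointRegular_opSq_add_opSq [CompleteSpace E] (hS : IsModuleLinear B S) (hT : IsModuleLinear B T) :
    IsSelfAdjointRegular B (opSq S + opSq T) ∧
      (opSq S).domain ⊓ (opSq T).domain = (opSq (S + T)).domain ∧
      (((opSq S).domain ⊓ (opSq T).domain : Submodule ℂ E) : Set E) ⊆ anticommDomain S T := by
  have hc := P.pos
  set s : ℝ := 1 + 2 * (c * (4 * c + 9)) with hs
  have hs0 : 0 < s := by positivity
  have hs1 : 1 ≤ s := by
    have : 0 ≤ c * (4 * c + 9) := by positivity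
    linarith
  have hs2 : 2 * (c * (4 * c + 9)) ≤ s := by linarith
  have hsol : ∀ σ : ℝ, |σ| = s → ∀ y, ∃ x ∈ (opSq (S + T)).domain,
      (x, y - (-(2 * s * σ * I : ℂ)) • x) ∈ (opSq S + opSq T).graph := by
    intro σ hσ y
    have him : ((s : ℂ) + σ * I).im = σ := by simp
    have h := P.exists_solution_sq (α := s + σ * I) (by
      rw [him]
      refine (norm_add_le _ _).trans ?_
      simp [hσ, abs_of_pos hs0, two_mul]) (by rwa [him, hσ]) (by rwa [him, hσ]) y
    have hsq : (σ : ℂ) ^ 2 = s ^ 2 := by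
      rw [← ofReal_pow, ← ofReal_pow, ← sq_abs σ, hσ]
    rwa [show ((s : ℂ) + σ * I) ^ 2 = 2 * s * σ * I by
      ring_nf; rw [I_sq, hsq]; ring] at h
  have hsym : SymRel B (opSq S + opSq T).graph := P.symS.opSq.add P.symT.opSq
  have hpos := hsol s (abs_of_pos hs0)
  have hneg := hsol (-s) (by rw [abs_neg, abs_of_pos hs0])
  set z : ℂ := -(2 * s * s * I) with hz
  have hzim : z.im ≠ 0 := by simp [hz, hs0.ne']
  have hz' : -(2 * s * ((-s : ℝ) : ℂ) * I) = -z := by rw [hz, ofReal_neg]; ring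
  rw [hz'] at hneg
  have hzstar : star z = -z := by
    simp [hz]
  have hle : (opSq (S + T)).domain ≤ (opSq S).domain ⊓ (opSq T).domain ∧
      ∀ x ∈ (opSq (S + T)).domain, x ∈ anticommDomain S T := by
    have : ∀ x ∈ (opSq (S + T)).domain, x ∈ (opSq S + opSq T).domain ∧
        x ∈ anticommDomain S T := fun x hx => by
      obtain ⟨e, he⟩ := LinearPMap.mem_domain_iff.mp hx
      obtain ⟨d, h1, h2⟩ := mem_graph_opSq_iff.mp he
      obtain ⟨u, v, k, hk, -, hH⟩ := P.exists_antiRel_of_sq h1 h2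
      exact ⟨LinearPMap.mem_domain_of_mem_graph hH, hk.mem_anticommDomain⟩
    exact ⟨fun x hx => (this x hx).1, fun x hx => (this x hx).2⟩
  have heq : (opSq S).domain ⊓ (opSq T).domain = (opSq (S + T)).domain := by
    refine le_antisymm (fun x hx => ?_) hle.1
    obtain ⟨h, hh⟩ := (LinearPMap.mem_domain_iff (f := opSq S + opSq T)).mp hx
    -- The solution x' lies in D((S + T)²), and injectivity of S² + T² + z gives x = x'.
    obtain ⟨x', hx', hh'⟩ := hpos (h + z • x)
    have := hsym.eq_zero_of_add_smul hzim (Submodule.sub_mem _ hh hh') (by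
      simp only; module)
    rwa [show x = x' from sub_eq_zero.mp this]
  obtain ⟨R', hR'⟩ := (P.symS.add P.symT).exists_imResolvent fun z hz => P.solvable_add hz
  have hs₁ : Solvable (opSq S + opSq T).graph z := fun y => (hpos y).imp fun x hx => hx.2
  have hs₂ : Solvable (opSq S + opSq T).graph (-z) := fun y => (hneg y).imp fun x hx => hx.2
  refine ⟨⟨hS.opSq.add hT.opSq, hsym.isSelfAdjointOp ?_ hs₁ (by rwa [hzstar]),
    isRegularOp_of_solvable hzim hs₁ hs₂⟩, heq, fun x hx => hle.2 x (heq ▸ hx)⟩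
  exact (hR'.dense_domain_opSq P.dense_domain_add).mono hle.1

end AnticommPair

/-! ### From the hypotheses to the working form of a pair. -/

theorem IsSelfAdjointOp.symRel {A : E →ₗ.[ℂ] E} (hA : IsSelfAdjointOp B A) :
    SymRel B A.graph := by
  intro x u y v hx hy
  obtain ⟨y', rfl, rfl⟩ := (LinearPMap.mem_graph_iff _).mp hy
  exact (hA.mem_graph_iff x u).mp hx y'

theorem IsSelfAdjointOp.isClosed {A : E →ₗ.[ℂ] E} (hA : IsSelfAdjointOp B A) :
    IsClosed (A.graph : Set (E × E)) := by
  have hcont : Continuous fun p : E × E => inner B p.1 p.2 := CStarModule.continuous_inner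
  have : (A.graph : Set (E × E)) =
      ⋂ y : A.domain, {p | inner B p.1 (A y) = inner B p.2 (y : E)} := by
    ext ⟨x, u⟩
    simp only [Set.mem_iInter]
    exact hA.mem_graph_iff x u
  rw [this]
  exact isClosed_iInter fun y => isClosed_eq (hcont.comp (continuous_fst.prodMk continuous_const))
    (hcont.comp (continuous_snd.prodMk continuous_const))

theorem IsSelfAdjointRegular.solvable [CompleteSpace E] {A : E →ₗ.[ℂ] E}
    (hA : IsSelfAdjointRegular B A) {w : ℂ} (hw : w.im ≠ 0) : Solvable A.graph w := by
  obtain ⟨z, hz, h1, h2⟩ := hA.regular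
  have hsym := hA.selfAdjoint.symRel
  have hcl := hA.selfAdjoint.isClosed
  refine hsym.solvable hz (hsym.solvable_of_dense hcl hz (h1.mono ?_))
    (hsym.solvable_of_dense hcl (by simpa using hz) (h2.mono ?_)) hw
  · rintro _ ⟨x, rfl⟩
    exact ⟨x, A x, A.mem_graph x, rfl⟩
  · rintro _ ⟨x, rfl⟩
    exact ⟨x, A x, A.mem_graph x, by simp [sub_eq_add_neg]⟩

theorem exists_seq_of_hasCore {T : E →ₗ.[ℂ] E} (hT : IsClosed (T.graph : Set (E × E)))
    {V : Submodule ℂ E} (hV : T.HasCore V) {x w : E} (h : (x, w) ∈ T.graph) :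
    ∃ f : ℕ → E × E, (∀ n, (f n).1 ∈ V ∧ f n ∈ T.graph) ∧ Tendsto f atTop (𝓝 (x, w)) := by
  have hle : T.domRestrict V ≤ T := LinearPMap.domRestrict_le
  have hcl : (T.domRestrict V).IsClosable :=
    (LinearPMap.IsClosed.isClosable hT).leIsClosable hle
  rw [← hV.closure_eq, ← hcl.graph_closure_eq_closure_graph] at h
  obtain ⟨f, hf, hlim⟩ := mem_closure_iff_seq_limit.mp h
  refine ⟨f, fun n => ⟨?_, LinearPMap.le_graph_of_le hle (hf n)⟩, hlim⟩
  exact (LinearPMap.mem_domain_of_mem_graph (hf n)).1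

theorem WeaklyAnticommuting.exists_anticommPair [CompleteSpace E] {S T : E →ₗ.[ℂ] E}
    (h : WeaklyAnticommuting B S T) : ∃ R c, AnticommPair B S T R c := by
  obtain ⟨R, hR⟩ := h.left.selfAdjoint.symRel.exists_imResolvent fun z hz => h.left.solvable hz
  obtain ⟨C₀, C₁, C₂, h0, h1, h2, hest⟩ := h.form_estimate
  obtain ⟨V, hV, l₀, hl₀, hVR⟩ := h.resolvent_core
  -- The added 1 ensures Cᵢ ≤ c², so the quadratic form estimate passes to a linear norm estimate.
  refine ⟨R, C₀ + C₁ + C₂ + 1, h.left.selfAdjoint.symRel, h.right.selfAdjoint.symRel,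
    h.left.selfAdjoint.isClosed, h.right.selfAdjoint.isClosed, h.left.selfAdjoint.dense_domain,
    h.right.selfAdjoint.dense_domain, fun z hz => h.right.solvable hz, hR, by positivity, ?_,
    V, fun x w hxw => exists_seq_of_hasCore h.right.selfAdjoint.isClosed hV hxw, l₀, hl₀,
    fun t ht x hx => ?_⟩
  · rintro x u v k ⟨hu, hv, p, q, hp, hq, rfl⟩
    obtain ⟨⟨x, hS⟩, rfl, rfl⟩ := (LinearPMap.mem_graph_iff _).mp hu
    obtain ⟨⟨x', hT⟩, e, rfl⟩ := (LinearPMap.mem_graph_iff _).mp hv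
    obtain rfl : x' = x := e
    obtain ⟨⟨u', hTS⟩, e, rfl⟩ := (LinearPMap.mem_graph_iff _).mp hp
    obtain rfl : u' = S ⟨x', hS⟩ := e
    obtain ⟨⟨v', hST⟩, e, rfl⟩ := (LinearPMap.mem_graph_iff _).mp hq
    obtain rfl : v' = T ⟨x', hT⟩ := e
    have key := CStarAlgebra.norm_le_norm_of_nonneg_of_le CStarModule.inner_self_nonneg
      (hest x' hS hT hST hTS)
    rw [← CStarModule.norm_sq_eq] at key
    have key2 := key.trans (norm_add₃_le)
    rw [norm_smul, norm_smul, norm_smul, ← CStarModule.norm_sq_eq, ← CStarModule.norm_sq_eq,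
      ← CStarModule.norm_sq_eq, Real.norm_of_nonneg h0.le, Real.norm_of_nonneg h1.le,
      Real.norm_of_nonneg h2.le] at key2
    rw [add_comm (T _)]
    refine le_of_sq_le_sq (key2.trans ?_) (by positivity)
    set a := ‖x'‖
    set b := ‖S ⟨x', hS⟩‖
    set d := ‖T ⟨x', hT⟩‖
    have ha : 0 ≤ a := norm_nonneg _
    have hb : 0 ≤ b := norm_nonneg _
    have hd : 0 ≤ d := norm_nonneg _
    have hc : ∀ C, 0 < C → C ≤ C₀ + C₁ + C₂ → C ≤ (C₀ + C₁ + C₂ + 1) ^ 2 := fun C hC hC' => by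
      nlinarith
    calc _ ≤ (C₀ + C₁ + C₂ + 1) ^ 2 * a ^ 2 + (C₀ + C₁ + C₂ + 1) ^ 2 * b ^ 2 +
          (C₀ + C₁ + C₂ + 1) ^ 2 * d ^ 2 := by
          gcongr <;> exact hc _ (by assumption) (by linarith)
      _ = (C₀ + C₁ + C₂ + 1) ^ 2 * (a ^ 2 + b ^ 2 + d ^ 2) := by ring
      _ ≤ (C₀ + C₁ + C₂ + 1) ^ 2 * (a + b + d) ^ 2 := by
          gcongr
          nlinarith [mul_nonneg ha hb, mul_nonneg ha hd, mul_nonneg hb hd]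
      _ = _ := by ring
  · have ht0 : t ≠ 0 := abs_pos.mp (hl₀.trans_le ht)
    have hm := hR.mem ht0 x
    refine exists_antiRel_of_mem_anticommDomain hm (hVR t ht ?_)
    have hdom := LinearPMap.mem_domain_of_mem_graph hm
    refine ⟨hdom, ?_⟩
    rw [S.mem_graph_snd_inj (S.mem_graph ⟨_, hdom⟩) hm rfl, sub_add_cancel]
    exact hx

end Squares

end HilbertModule

theorem theorem5p1 {B E : Type*} [NonUnitalCStarAlgebra B] [PartialOrder B] [StarOrderedRing B]
    [NormedAddCommGroup E] [NormedSpace ℂ E] [CompleteSpace E] [SMul B E] [CStarModule B E]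
    (S T : E →ₗ.[ℂ] E) (hST : HilbertModule.WeaklyAnticommuting B S T) :
    (HilbertModule.opSq S + HilbertModule.opSq T).domain =
        (HilbertModule.opSq S).domain ⊓ (HilbertModule.opSq T).domain ∧
      HilbertModule.IsSelfAdjointRegular B (HilbertModule.opSq S + HilbertModule.opSq T) ∧
      (HilbertModule.opSq S).domain ⊓ (HilbertModule.opSq T).domain =
        (HilbertModule.opSq (S + T)).domain ∧
      (((HilbertModule.opSq S).domain ⊓ (HilbertModule.opSq T).domain : Submodule ℂ E) : Set E) ⊆
        HilbertModule.anticommDomain S T := by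
  obtain ⟨R, c, P⟩ := hST.exists_anticommPair
  exact ⟨rfl, P.isSelfAdjointRegular_opSq_add_opSq hST.left.moduleLinear hST.right.moduleLinear⟩
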